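/- Let $(M^{\mathrm{out}},g^{\mathrm{out}})$ be a smooth Riemannian manifold of dimension $m+1$ and let $M\subset M^{\mathrm{out}}$ be a (possibly only immersed) smooth hypersurface with induced metric $g$, Levi-Civita connection $\nabla$ and curvature $R$. Let $N$ be a (local) smooth unit normal field, let $\mathrm{II}$ be the second fundamental form, $\nabla^{\mathrm{out}}_XY=\nabla_XY+\mathrm{II}(X,Y)\,N$, also considered as the $TM$-valued $1$-form $X\mapsto\mathrm{II}_X$ with $g(\mathrm{II}_X,Y)=\mathrm{II}(X,Y)$, and put $(\mathrm{II}\wedge N)_XZ:=g^{\mathrm{out}}(\mathrm{II}_X,Z)\,N-g^{\mathrm{out}}(N,Z)\,\mathrm{II}_X$. Denote by $\nabla$ also the direct sum connection on $TM^{\mathrm{out}}|_M=TM\oplus\mathrm{Norm}\,M$ of the Levi-Civita connection and the metric connection of $\mathrm{Norm}\,M$. Suppose that $M$ is permeable, i.e. the $TM$-valued $3$-form $$(R\,\mathrm{II})(X,Y,Z):=R_{X,Y}\mathrm{II}_Z+R_{Y,Z}\mathrm{II}_X+R_{Z,X}\mathrm{II}_Y$$ vanishes identically. Let $F(z)=1+O(z^2)$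 be an even formal power series with complex (for example real) coefficients, let $\log F(z)=\sum_{k>0}f_kz^{2k}$ and $LF(z):=\log F(z)/z^2$. For a connection $\nabla$ on a real vector bundle $VM$ with curvature $R^\nabla$ and an $\mathrm{End}\,VM$-valued $1$-form $\dot\nabla$ define the logarithmic transgression form $$\delta(\log F)(VM,\nabla,\dot\nabla):=\sum_{k>0}k\,f_k\,\mathrm{tr}\Big(\frac{\dot\nabla}{2\pi i}\Big(\frac{R^\nabla}{2\pi i}\Big)^{2k-1}\Big),$$ and for a curve $(\nabla^t)_{0\le t\le1}$ of connections define the transgression form $$\mathrm{trans}\,F:=\int_0^1\exp\Big(\int_0^t d\,\delta(\log F)\big(VM,\nabla^\tau,\tfrac{d}{d\tau}\nabla^\tau\big)\,d\tau\Big)\,\delta(\log F)\big(VM,\nabla^t,\tfrac{d}{dt}\nabla^t\big)\,dt.$$ Let $\xi:=g(d^\nabla\mathrm{II},\mathrm{II})$ be the wedge product of $d^\nabla\mathrm{II}$ and $\mathrm{II}$ contracted with $g$, a $3$-form on $M$. Then the linear interpolation $\nabla^t:=\nabla+t\,\mathrm{II}\wedge N$ connects $\nabla^0=\nabla$ with $\nabla^1=\nabla^{\mathrm{out}}|_M$,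 for all $t\in\mathbb R$ $$\delta(\log F)\big(TM^{\mathrm{out}}|_M,\nabla^t,\mathrm{II}\wedge N\big)=\frac{d}{dt}\Big(\frac{t^2\,\xi}{4\pi^2}\;LF\Big(\sqrt{\tfrac{t^2\,d\xi}{4\pi^2}}\Big)\Big),$$ and the transgression form of the curve $(\nabla^t)_{0\le t\le1}$ equals $$\mathrm{trans}\,F\big(TM^{\mathrm{out}}|_M,\nabla,\nabla+\mathrm{II}\wedge N\big)=\int_0^1F\Big(\sqrt{\tfrac{t^2\,d\xi}{4\pi^2}}\Big)\;\frac{d}{dt}\Big(\frac{t^2\,\xi}{4\pi^2}\;LF\Big(\sqrt{\tfrac{t^2\,d\xi}{4\pi^2}}\Big)\Big)\,dt.$$ All products are taken in the algebra of complex valued differential forms; $F$ and $LF$ are even, so that no square root of $d\xi$ is actually needed, and the series are finite because forms of positive degree are nilpotent. -/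

import Mathlib

open scoped Manifold ContDiff Bundle

noncomputable section

namespace PermeableHypersurface

/-! ## Complex valued differential forms in coordinates `x¹, …, xᵐ` -/

/-- Coordinate space. -/
abbrev Coord (n : ℕ) := EuclideanSpace ℝ (Fin n)

/-- The values of complex valued differential forms of arbitrary degree in coordinates
`x¹, …, xᵐ`: the exterior algebra on the symbols `dx¹, …, dxᵐ`. The wedge product is the
multiplication of this algebra. A differential form is a function `Coord m → Forms m`. -/
abbrev Forms (m : ℕ) := ExteriorAlgebra ℂ (Fin m → ℂ)

/-- The coordinate differential `dxⁱ`. -/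
def dx {m : ℕ} (i : Fin m) : Forms m := ExteriorAlgebra.ι ℂ (Pi.single i (1 : ℂ))

/-- The basis of the products `dx^{i₁} ∧ … ∧ dx^{iₚ}` with `i₁ < … < iₚ`. -/
def formBasis (m : ℕ) : Module.Basis (Finset (Fin m)) ℂ (Forms m) :=
  (Pi.basisFun ℂ (Fin m)).ExteriorAlgebra

/-- The coefficient of a form at `dx^{i₁} ∧ … ∧ dx^{iₚ}` for `s = {i₁ < … < iₚ}`. -/
def formCoeff {m : ℕ} (s : Finset (Fin m)) : Forms m →ₗ[ℂ] ℂ := (formBasis m).coord s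

/-- Partial derivative `∂ᵢ u` of a real function of `n` coordinates. -/
def pd {n : ℕ} (i : Fin n) (u : Coord n → ℝ) (x : Coord n) : ℝ :=
  fderiv ℝ u x (EuclideanSpace.single i 1)

/-- Exterior derivative `d(∑ η_s dx^s) = ∑ ∂ᵢ η_s dxⁱ ∧ dx^s`. -/
def extD {m : ℕ} (η : Coord m → Forms m) (x : Coord m) : Forms m :=
  ∑ s : Finset (Fin m), ∑ i : Fin m,
    (fderiv ℝ (fun y => formCoeff s (η y)) x (EuclideanSpace.single i 1)) •
      (dx i * formBasis m s)

/-- `c' = (d/dt) c (t)` for a curve of forms at a fixed point (coefficient by coefficient). -/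
def HasTimeDerivAt {m : ℕ} (c : ℝ → Forms m) (c' : Forms m) (t : ℝ) : Prop :=
  ∀ s : Finset (Fin m), HasDerivAt (fun τ => formCoeff s (c τ)) (formCoeff s c') t

/-- The derivative `(d/dt) c (t)` of a curve of forms at a fixed point. -/
def timeDeriv {m : ℕ} (c : ℝ → Forms m) (t : ℝ) : Forms m :=
  ∑ s : Finset (Fin m), deriv (fun τ => formCoeff s (c τ)) t • formBasis m s

/-- The integral `∫_a^b c(τ) dτ` of a curve of forms at a fixed point. -/
def timeIntegral {m : ℕ} (c : ℝ → Forms m) (a b : ℝ) : Forms m :=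
  ∑ s : Finset (Fin m), (∫ τ in a..b, formCoeff s (c τ)) • formBasis m s

/-- The value `∑ₖ aₖ ηᵏ` of the power series `∑ₖ aₖ zᵏ` at a form `η` without constant term;
all powers of such an `η` beyond the `m`-th one vanish. -/
def evalSeries {m : ℕ} (F : PowerSeries ℂ) (η : Forms m) : Forms m :=
  ∑ k ∈ Finset.range (m + 1), PowerSeries.coeff k F • η ^ k

/-- The value `F(√η) = ∑ₖ F₂ₖ ηᵏ` of an even power series `F(z) = ∑ₖ F₂ₖ z²ᵏ` at the square root
of a form `η` without constant term. -/
def evalSqrt {m : ℕ} (F : PowerSeries ℂ) (η : Forms m) : Forms m :=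
  ∑ k ∈ Finset.range (m + 1), PowerSeries.coeff (2 * k) F • η ^ k

/-! ## Connections and transgression forms -/

/-- `F(z) = 1 + O(z²)` is an even formal power series. -/
def IsEvenUnitSeries (F : PowerSeries ℂ) : Prop :=
  PowerSeries.constantCoeff F = 1 ∧ ∀ n : ℕ, Odd n → PowerSeries.coeff n F = 0

/-- The power series `LF(z) = log F(z) / z²`. -/
def LF (F : PowerSeries ℂ) : PowerSeries ℂ :=
  PowerSeries.mk fun n => PowerSeries.coeff (n + 2) (PowerSeries.logOf F)

/-- The curvature `R = dA + A ∧ A` of the connection `∇ = d + A` given with respect to a local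
frame of a vector bundle by the matrix `A` of `1`-forms (`∇ e_b = ∑ₐ A_{ab} eₐ`). -/
def curvature {m : ℕ} {κ : Type*} [Fintype κ] (A : Coord m → Matrix κ κ (Forms m))
    (x : Coord m) : Matrix κ κ (Forms m) :=
  Matrix.of (fun a b => extD (fun y => A y a b) x) + A x * A x

/-- The logarithmic transgression form
`δ(log F)(∇, ∇̇) = ∑_{k>0} k fₖ tr((∇̇/2πi) (R/2πi)^{2k-1})`, `log F(z) = ∑_{k>0} fₖ z²ᵏ`, of a
connection `∇ = d + A` and a variation `∇̇ = B`. The `k`-th summand has degree `4k - 1` and thus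
vanishes for `k > m`. -/
def logTransgression {m : ℕ} {κ : Type*} [Fintype κ] [DecidableEq κ] (F : PowerSeries ℂ)
    (A B : Coord m → Matrix κ κ (Forms m)) (x : Coord m) : Forms m :=
  ∑ k ∈ Finset.Icc 1 m, ((k : ℂ) * PowerSeries.coeff (2 * k) (PowerSeries.logOf F)) •
    Matrix.trace (((2 * (Real.pi : ℂ) * Complex.I)⁻¹ • B x) *
      ((2 * (Real.pi : ℂ) * Complex.I)⁻¹ • curvature A x) ^ (2 * k - 1))

/-- The velocity `d/dt ∇ᵗ` of a curve `∇ᵗ = d + Aᵗ` of connections. -/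
def connVelocity {m : ℕ} {κ : Type*} (A : ℝ → Coord m → Matrix κ κ (Forms m)) (t : ℝ)
    (x : Coord m) : Matrix κ κ (Forms m) :=
  Matrix.of fun a b => timeDeriv (fun τ => A τ x a b) t

/-- The transgression form
`trans F = ∫₀¹ exp(∫₀ᵗ d δ(log F)(∇^τ, d/dτ ∇^τ) dτ) ∧ δ(log F)(∇ᵗ, d/dt ∇ᵗ) dt`
of a curve `∇ᵗ = d + Aᵗ`, `0 ≤ t ≤ 1`, of connections. -/
def transgression {m : ℕ} {κ : Type*} [Fintype κ] [DecidableEq κ] (F : PowerSeries ℂ)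
    (A : ℝ → Coord m → Matrix κ κ (Forms m)) (x : Coord m) : Forms m :=
  timeIntegral (fun t =>
    evalSeries (PowerSeries.exp ℂ)
      (timeIntegral (fun τ => extD (logTransgression F (A τ) (connVelocity A τ)) x) 0 t) *
    logTransgression F (A t) (connVelocity A t) x) 0 1

/-! ## Riemannian geometry of a hypersurface in coordinates -/

/-- Christoffel symbols `Γᶜ_{ab} = ½ ∑_d G^{cd} (∂ₐ G_{bd} + ∂_b G_{ad} - ∂_d G_{ab})` of the
Levi-Civita connection of the metric `G`. -/
def christoffel {n : ℕ} (G : Coord n → Matrix (Fin n) (Fin n) ℝ) (y : Coord n)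
    (c a b : Fin n) : ℝ :=
  1 / 2 * ∑ d, (G y)⁻¹ c d *
    (pd a (fun z => G z b d) y + pd b (fun z => G z a d) y - pd d (fun z => G z a b) y)

/-- Coordinate expression of a hypersurface with unit normal field: the metric `G` of the outer
manifold, the inclusion `f` and the components of the normal field `N` along `f`. -/
structure Patch (m : ℕ) where
  G : Coord (m + 1) → Matrix (Fin (m + 1)) (Fin (m + 1)) ℝ
  f : Coord m → Coord (m + 1)
  N : Coord m → Fin (m + 1) → ℝ

namespace Patch

variable {m : ℕ} (P : Patch m)

/-- The components of the tangent vector field `∂ᵢ f`. -/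
def tangent (i : Fin m) (x : Coord m) (c : Fin (m + 1)) : ℝ := pd i (fun y => P.f y c) x

/-- The induced metric `g_{ij} = g^out(∂ᵢ f, ∂ⱼ f)`. -/
def metric (x : Coord m) : Matrix (Fin m) (Fin m) ℝ :=
  Matrix.of fun i j => ∑ a, ∑ b, P.G (P.f x) a b * P.tangent i x a * P.tangent j x b

/-- The restricted Levi-Civita connection of the outer manifold: the components of
`∇^out_{∂ᵢ} s` for a section `s` of `TM^out|_M`. -/
def covOut (i : Fin m) (s : Coord m → Fin (m + 1) → ℝ) (x : Coord m) (c : Fin (m + 1)) : ℝ :=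
  pd i (fun y => s y c) x +
    ∑ a, ∑ b, christoffel P.G (P.f x) c a b * P.tangent i x a * s x b

/-- The second fundamental form `II(∂ᵢ, ∂ⱼ) = g^out(∇^out_{∂ᵢ} ∂ⱼ f, N)`. -/
def secondFF (x : Coord m) (i j : Fin m) : ℝ :=
  ∑ a, ∑ b, P.G (P.f x) a b * P.covOut i (P.tangent j) x a * P.N x b

/-- The Weingarten map: `II_{∂ᵢ} = ∑ₖ IIᵏᵢ ∂ₖ` with `g(II_X, Y) = II(X, Y)`. -/
def weingarten (x : Coord m) (k i : Fin m) : ℝ :=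
  ∑ j, (P.metric x)⁻¹ k j * P.secondFF x i j

/-- The components `IIᵏ` of the second fundamental form as a vector valued `1`-form. -/
def vecII (x : Coord m) (k : Fin m) : Forms m := ∑ i, (P.weingarten x k i : ℂ) • dx i

/-- The `1`-forms `g(II, ∂ⱼ)`. -/
def covecII (x : Coord m) (j : Fin m) : Forms m := ∑ i, (P.secondFF x i j : ℂ) • dx i

/-- The connection matrix of the Levi-Civita connection of the induced metric in the frame
`∂₁, …, ∂ₘ` of `TM`. -/
def leviCivita (x : Coord m) : Matrix (Fin m) (Fin m) (Forms m) :=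
  Matrix.of fun k j => ∑ i, (christoffel P.metric x k i j : ℂ) • dx i

/-- The components of the covariant exterior derivative `d^∇ II`, a vector valued `2`-form. -/
def dII (x : Coord m) (k : Fin m) : Forms m :=
  extD (fun y => P.vecII y k) x + ∑ j, P.leviCivita x k j * P.vecII x j

/-- The components of the vector valued `3`-form
`(R II)(X, Y, Z) = R_{X,Y} II_Z + R_{Y,Z} II_X + R_{Z,X} II_Y`. -/
def curvII (x : Coord m) (k : Fin m) : Forms m :=
  ∑ j, curvature P.leviCivita x k j * P.vecII x j

/-- The `3`-form `ξ = g(d^∇ II, II)`. -/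
def xi (x : Coord m) : Forms m :=
  ∑ k, ∑ l, (P.metric x k l : ℂ) • (P.dII x k * P.vecII x l)

/-- The frame `∂₁ f, …, ∂ₘ f, N` of `TM^out|_M = TM ⊕ Norm M`. -/
def frame : Fin m ⊕ Unit → Coord m → Fin (m + 1) → ℝ
  | Sum.inl j => P.tangent j
  | Sum.inr _ => P.N

/-- The connection matrix, in the frame `∂₁ f, …, ∂ₘ f, N`, of the direct sum `∇` of the
Levi-Civita connection of `M` and the metric connection of `Norm M`, for which the unit normal
field `N` is parallel. -/
def nabla (x : Coord m) : Matrix (Fin m ⊕ Unit) (Fin m ⊕ Unit) (Forms m) :=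
  Matrix.fromBlocks (P.leviCivita x) 0 0 0

/-- The matrix, in the frame `∂₁ f, …, ∂ₘ f, N`, of the endomorphism valued `1`-form
`(II ∧ N)_X Z = g^out(II_X, Z) N - g^out(N, Z) II_X`. -/
def wedgeN (x : Coord m) : Matrix (Fin m ⊕ Unit) (Fin m ⊕ Unit) (Forms m) :=
  Matrix.fromBlocks 0 (Matrix.of fun k _ => -P.vecII x k) (Matrix.of fun _ j => P.covecII x j) 0

/-- The linear interpolation `∇ᵗ = ∇ + t II ∧ N`. -/
def nablaT (t : ℝ) (x : Coord m) : Matrix (Fin m ⊕ Unit) (Fin m ⊕ Unit) (Forms m) :=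
  P.nabla x + (t : ℂ) • P.wedgeN x

/-- At the point `x` the restricted connection `∇^out|_M` has the connection matrix `A` in the
frame `e = (∂₁ f, …, ∂ₘ f, N)`, i.e. `∇^out e_β = ∑_α A_{αβ} e_α`. -/
def IsOuterConnectionMatrix (A : Matrix (Fin m ⊕ Unit) (Fin m ⊕ Unit) (Forms m))
    (x : Coord m) : Prop :=
  ∀ (β : Fin m ⊕ Unit) (c : Fin (m + 1)),
    ∑ i, (P.covOut i (P.frame β) x c : ℂ) • dx i = ∑ α, (P.frame α x c : ℂ) • A α β

end Patch

/-! ## Hypersurfaces of Riemannian manifolds -/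

section Manifold

variable {m : ℕ}
  {M : Type*} [TopologicalSpace M] [ChartedSpace (EuclideanSpace ℝ (Fin m)) M]
  {M' : Type*} [TopologicalSpace M'] [ChartedSpace (EuclideanSpace ℝ (Fin (m + 1))) M']
  [IsManifold (𝓡 (m + 1)) ∞ M']

/-- `ι : M → M'` is a smooth immersion of a manifold of dimension `m` as a hypersurface. -/
def IsHypersurface (ι : M → M') : Prop :=
  ContMDiff (𝓡 m) (𝓡 (m + 1)) ∞ ι ∧
    ∀ p : M, Function.Injective (mfderiv (𝓡 m) (𝓡 (m + 1)) ι p)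

/-- `N` is a smooth unit normal field of the hypersurface `ι : M → M'` on `U ⊆ M`. -/
def IsUnitNormal
    (g : Bundle.ContMDiffRiemannianMetric (𝓡 (m + 1)) ∞ (EuclideanSpace ℝ (Fin (m + 1)))
      (fun q : M' => TangentSpace (𝓡 (m + 1)) q))
    (ι : M → M') (U : Set M) (N : ∀ p : M, TangentSpace (𝓡 (m + 1)) (ι p)) : Prop :=
  ContMDiffOn (𝓡 m) (𝓡 (m + 1)).tangent ∞
      (fun p => (⟨ι p, N p⟩ : TangentBundle (𝓡 (m + 1)) M')) U ∧
    ∀ p ∈ U, g.inner (ι p) (N p) (N p) = 1 ∧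
      ∀ v : TangentSpace (𝓡 m) p,
        g.inner (ι p) (mfderiv (𝓡 m) (𝓡 (m + 1)) ι p v) (N p) = 0

/-- The coordinate expression of a hypersurface with normal field `N` in a chart `φ` of `M` and
a chart `ψ` of the outer manifold. -/
def patch
    (g : Bundle.ContMDiffRiemannianMetric (𝓡 (m + 1)) ∞ (EuclideanSpace ℝ (Fin (m + 1)))
      (fun q : M' => TangentSpace (𝓡 (m + 1)) q))
    (ι : M → M') (N : ∀ p : M, TangentSpace (𝓡 (m + 1)) (ι p))
    (φ : OpenPartialHomeomorph M (EuclideanSpace ℝ (Fin m)))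
    (ψ : OpenPartialHomeomorph M' (EuclideanSpace ℝ (Fin (m + 1)))) : Patch m where
  G := fun y => Matrix.of fun a b =>
    g.inner (ψ.symm y)
      (mfderiv (𝓡 (m + 1)) (𝓡 (m + 1)) ψ.symm y (EuclideanSpace.single a (1 : ℝ)))
      (mfderiv (𝓡 (m + 1)) (𝓡 (m + 1)) ψ.symm y (EuclideanSpace.single b (1 : ℝ)))
  f := fun x => ψ (ι (φ.symm x))
  N := fun x c =>
    (show EuclideanSpace ℝ (Fin (m + 1)) from
      mfderiv (𝓡 (m + 1)) (𝓡 (m + 1)) ψ (ι (φ.symm x)) (N (φ.symm x))) c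

/-- The points `x` in the range of the chart `φ` at which the coordinate expression in the charts
`φ` and `ψ` of a hypersurface with normal field defined on `U` makes sense. -/
def patchDomain (ι : M → M') (U : Set M)
    (φ : OpenPartialHomeomorph M (EuclideanSpace ℝ (Fin m)))
    (ψ : OpenPartialHomeomorph M' (EuclideanSpace ℝ (Fin (m + 1)))) :
    Set (EuclideanSpace ℝ (Fin m)) :=
  {x | x ∈ φ.target ∧ φ.symm x ∈ U ∧ ι (φ.symm x) ∈ ψ.source}

/-- The hypersurface `ι : M → M'` is permeable: the vector valued `3`-form `R II` vanishes
identically, where `II` is taken with respect to local unit normal fields. -/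
def IsPermeable
    (g : Bundle.ContMDiffRiemannianMetric (𝓡 (m + 1)) ∞ (EuclideanSpace ℝ (Fin (m + 1)))
      (fun q : M' => TangentSpace (𝓡 (m + 1)) q))
    (ι : M → M') : Prop :=
  ∀ (U : Set M) (N : ∀ p : M, TangentSpace (𝓡 (m + 1)) (ι p)),
    IsOpen U → IsUnitNormal g ι U N →
    ∀ φ ∈ IsManifold.maximalAtlas (𝓡 m) ∞ M,
    ∀ ψ ∈ IsManifold.maximalAtlas (𝓡 (m + 1)) ∞ M',
    ∀ x ∈ patchDomain ι U φ ψ, ∀ k : Fin m, (patch g ι N φ ψ).curvII x k = 0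

end Manifold

end PermeableHypersurface

end

/-!
In the splitting `TM ⊕ Norm M` the curvature of `∇ᵗ = ∇ + t II ∧ N` is a block matrix: its
tangential block is `R - t² II ∧ g(II, ·)`, whose first summand is annihilated by `II` when `M` is
permeable, and its mixed blocks are `±t d^∇ II`. Differentiating `R II = 0` and using the Bianchi
identity, `R` also annihilates `d^∇ II`, so in `tr (II ∧ N · (R^t)^{2k-1})` only products of `g(II,
d^∇ II) = ±ξ` and `g(d^∇ II, d^∇ II) = dξ` survive, and `ξ` times itself is zero. This makes `δ(log
F)` an explicit multiple of `ξ (dξ)^{k-1}`, which is the time derivative of a polynomial in `t`; its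
exterior derivative integrates to `log F (√(t² dξ / 4π²))`, and the exponential turns this back into
`F`.
-/

noncomputable section

namespace PermeableHypersurface

section ExteriorAlgebra

variable {R M : Type*} [CommRing R] [AddCommGroup M] [Module R M]

theorem ι_mul_of_mem_exteriorPower {p : ℕ} {a : ExteriorAlgebra R M} (ha : a ∈ ⋀[R]^p M) (v : M) :
    ExteriorAlgebra.ι R v * a = (-1) ^ p * (a * ExteriorAlgebra.ι R v) := by
  induction ha using Submodule.pow_induction_on_left' with
  | algebraMap r => simp [Algebra.commutes]
  | add a b _ _ _ ha hb => rw [mul_add, ha, hb, add_mul, mul_add]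
  | mem_mul u hu n a _ ih =>
    obtain ⟨u, rfl⟩ := hu
    rw [← mul_assoc, eq_neg_of_add_eq_zero_left (ExteriorAlgebra.ι_add_mul_swap v u), neg_mul,
      mul_assoc, ih, pow_succ', neg_one_mul, neg_mul,
      ((Commute.neg_one_right (ExteriorAlgebra.ι R u)).pow_right n).left_comm, mul_assoc]

theorem mul_comm_of_mem_exteriorPower {p q : ℕ} {a b : ExteriorAlgebra R M} (ha : a ∈ ⋀[R]^p M)
    (hb : b ∈ ⋀[R]^q M) : a * b = (-1) ^ (p * q) * (b * a) := by
  induction ha using Submodule.pow_induction_on_left' with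
  | algebraMap r => simp [Algebra.commutes]
  | add a a' _ _ _ ha ha' => rw [add_mul, ha, ha', mul_add, mul_add]
  | mem_mul u hu n a _ ih =>
    obtain ⟨u, rfl⟩ := hu
    rw [mul_assoc, ih, ((Commute.neg_one_right (ExteriorAlgebra.ι R u)).pow_right _).left_comm,
      ← mul_assoc (ExteriorAlgebra.ι R u), ι_mul_of_mem_exteriorPower hb, mul_assoc, mul_assoc,
      ← mul_assoc, ← pow_add, Nat.succ_mul]

theorem mem_center_of_mem_exteriorPower_of_even {p : ℕ} (hp : Even p) {a : ExteriorAlgebra R M}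
    (ha : a ∈ ⋀[R]^p M) : a ∈ Subalgebra.center R (ExteriorAlgebra R M) := by
  rw [Subalgebra.mem_center_iff]
  intro b
  induction b using ExteriorAlgebra.induction with
  | algebraMap r => exact Algebra.commutes r a
  | ι v => rw [ι_mul_of_mem_exteriorPower ha, hp.neg_one_pow, one_mul]
  | mul b c hb hc => rw [mul_assoc, hc, ← mul_assoc, hb, mul_assoc]
  | add b c hb hc => rw [add_mul, mul_add, hb, hc]

theorem mul_self_eq_zero_of_mem_exteriorPower_of_odd [Invertible (2 : R)] {p : ℕ} (hp : Odd p)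
    {a : ExteriorAlgebra R M} (ha : a ∈ ⋀[R]^p M) : a * a = 0 := by
  have h := mul_comm_of_mem_exteriorPower ha ha
  rw [(hp.mul hp).neg_one_pow, neg_one_mul, ← add_eq_zero_iff_eq_neg, ← two_smul R] at h
  exact (IsUnit.smul_eq_zero (isUnit_of_invertible (2 : R))).1 h

theorem eq_zero_of_mem_exteriorPower_of_finrank_lt {K V : Type*} [Field K] [AddCommGroup V]
    [Module K V] [FiniteDimensional K V] {n : ℕ} (hn : Module.finrank K V < n)
    {a : ExteriorAlgebra K V} (ha : a ∈ ⋀[K]^n V) : a = 0 := by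
  have h : Module.finrank K (⋀[K]^n V) = 0 := by
    rw [exteriorPower.finrank_eq, Nat.choose_eq_zero_of_lt hn]
  rw [Submodule.finrank_eq_zero.1 h] at ha
  exact ha

end ExteriorAlgebra

section Forms

variable {m : ℕ}

theorem formCoeff_formBasis (s t : Finset (Fin m)) :
    formCoeff s (formBasis m t) = if t = s then 1 else 0 := by
  simp [formCoeff, Finsupp.single_apply]

theorem sum_formCoeff_smul_formBasis (a : Forms m) : ∑ s, formCoeff s a • formBasis m s = a :=
  (formBasis m).sum_repr a

theorem formCoeff_sum_smul_formBasis (c : Finset (Fin m) → ℂ) (s : Finset (Fin m)) :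
    formCoeff s (∑ t, c t • formBasis m t) = c s := by
  simp [formCoeff_formBasis]

theorem forms_ext {a b : Forms m} (h : ∀ s, formCoeff s a = formCoeff s b) : a = b :=
  (formBasis m).ext_elem h

theorem formCoeff_mul (s : Finset (Fin m)) (a b : Forms m) :
    formCoeff s (a * b) = ∑ p, ∑ q, formCoeff p a * formCoeff q b *
      formCoeff s (formBasis m p * formBasis m q) := by
  conv_lhs => rw [← sum_formCoeff_smul_formBasis a, ← sum_formCoeff_smul_formBasis b]
  simp only [Finset.sum_mul_sum, smul_mul_smul_comm, map_sum, map_smul, smul_eq_mul]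

theorem dx_mem_exteriorPower (i : Fin m) : dx i ∈ ⋀[ℂ]^1 (Fin m → ℂ) := by
  rw [ExteriorAlgebra.exteriorPower, pow_one]
  exact ⟨_, rfl⟩

theorem dx_mul_of_mem_exteriorPower {p : ℕ} {a : Forms m} (ha : a ∈ ⋀[ℂ]^p (Fin m → ℂ))
    (i : Fin m) : dx i * a = (-1) ^ p * (a * dx i) :=
  ι_mul_of_mem_exteriorPower ha _

theorem dx_mul_dx (i j : Fin m) : (dx i * dx j : Forms m) = -(dx j * dx i) := by
  simpa using dx_mul_of_mem_exteriorPower (dx_mem_exteriorPower j) i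

theorem sum_smul_dx_mem_exteriorPower (c : Fin m → ℂ) :
    ∑ i, c i • dx i ∈ ⋀[ℂ]^1 (Fin m → ℂ) :=
  Submodule.sum_mem _ fun i _ => Submodule.smul_mem _ _ (dx_mem_exteriorPower i)

end Forms

section FormCalculus

variable {m : ℕ}

/-- Smoothness at a point of a complex valued differential form, coefficient by coefficient. -/
def FormSmoothAt (η : Coord m → Forms m) (x : Coord m) : Prop :=
  ∀ s, ContDiffAt ℝ ∞ (fun y => formCoeff s (η y)) x

/-- The partial derivative `∂ᵢ η` of a differential form, taken coefficient by coefficient. -/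
def formPd (i : Fin m) (η : Coord m → Forms m) (x : Coord m) : Forms m :=
  ∑ s : Finset (Fin m), (fderiv ℝ (fun y => formCoeff s (η y)) x (EuclideanSpace.single i 1)) •
    formBasis m s

variable {η θ : Coord m → Forms m} {x : Coord m}

theorem formCoeff_formPd (s : Finset (Fin m)) (i : Fin m) (η : Coord m → Forms m) (x : Coord m) :
    formCoeff s (formPd i η x) =
      fderiv ℝ (fun y => formCoeff s (η y)) x (EuclideanSpace.single i 1) :=
  formCoeff_sum_smul_formBasis _ s

theorem extD_eq_sum_dx_mul_formPd (η : Coord m → Forms m) (x : Coord m) :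
    extD η x = ∑ i, dx i * formPd i η x := by
  simp only [extD, formPd, Finset.mul_sum, mul_smul_comm]
  exact Finset.sum_comm

theorem FormSmoothAt.differentiableAt (hη : FormSmoothAt η x) (s : Finset (Fin m)) :
    DifferentiableAt ℝ (fun y => formCoeff s (η y)) x :=
  (hη s).differentiableAt (by simp)

theorem FormSmoothAt.const (a : Forms m) : FormSmoothAt (fun _ => a) x :=
  fun _ => contDiffAt_const

theorem FormSmoothAt.sum {α : Type*} {A : Finset α} {η : α → Coord m → Forms m}
    (hη : ∀ a ∈ A, FormSmoothAt (η a) x) : FormSmoothAt (fun y => ∑ a ∈ A, η a y) x := fun s => by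
  simp only [map_sum]
  exact ContDiffAt.sum fun a ha => hη a ha s

theorem FormSmoothAt.add (hη : FormSmoothAt η x) (hθ : FormSmoothAt θ x) :
    FormSmoothAt (fun y => η y + θ y) x := fun s => by
  simpa only [map_add] using (hη s).add (hθ s)

theorem FormSmoothAt.const_smul (c : ℂ) (hη : FormSmoothAt η x) :
    FormSmoothAt (fun y => c • η y) x := fun s => by
  simpa only [map_smul] using (hη s).const_smul c

theorem FormSmoothAt.mul (hη : FormSmoothAt η x) (hθ : FormSmoothAt θ x) :
    FormSmoothAt (fun y => η y * θ y) x := fun s => by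
  simp only [fun y => formCoeff_mul s (η y) (θ y)]
  exact ContDiffAt.sum fun p _ => ContDiffAt.sum fun q _ => ((hη p).mul (hθ q)).mul contDiffAt_const

theorem FormSmoothAt.pow (hη : FormSmoothAt η x) (k : ℕ) : FormSmoothAt (fun y => η y ^ k) x := by
  induction k with
  | zero => simpa only [pow_zero] using FormSmoothAt.const 1
  | succ k ih => simpa only [pow_succ] using ih.mul hη

theorem FormSmoothAt.ofReal_smul {u : Coord m → ℝ} (hu : ContDiffAt ℝ ∞ u x)
    (hη : FormSmoothAt η x) : FormSmoothAt (fun y => (u y : ℂ) • η y) x := fun s => by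
  simp only [map_smul, smul_eq_mul]
  exact (Complex.ofRealCLM.contDiff.contDiffAt.comp x hu).mul (hη s)

theorem FormSmoothAt.formPd (hη : FormSmoothAt η x) (i : Fin m) :
    FormSmoothAt (formPd i η) x := fun s => by
  simp only [formCoeff_formPd]
  exact ((hη s).fderiv_right (m := ∞) (by simp)).clm_apply contDiffAt_const

theorem FormSmoothAt.extD (hη : FormSmoothAt η x) : FormSmoothAt (extD η) x := by
  rw [funext (extD_eq_sum_dx_mul_formPd η)]
  exact FormSmoothAt.sum fun i _ => (FormSmoothAt.const _).mul (hη.formPd i)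

theorem formPd_congr (h : η =ᶠ[nhds x] θ) (i : Fin m) : formPd i η x = formPd i θ x := by
  refine forms_ext fun s => ?_
  simp only [formCoeff_formPd]
  have hs : (fun y => formCoeff s (η y)) =ᶠ[nhds x] fun y => formCoeff s (θ y) :=
    h.fun_comp (formCoeff s)
  rw [hs.fderiv_eq]

theorem formPd_const (a : Forms m) (i : Fin m) : formPd i (fun _ => a) x = 0 :=
  forms_ext fun s => by simp [formCoeff_formPd]

theorem formPd_sum {α : Type*} {A : Finset α} {η : α → Coord m → Forms m}
    (hη : ∀ a ∈ A, FormSmoothAt (η a) x) (i : Fin m) :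
    formPd i (fun y => ∑ a ∈ A, η a y) x = ∑ a ∈ A, formPd i (η a) x := by
  refine forms_ext fun s => ?_
  simp only [formCoeff_formPd, map_sum]
  rw [fderiv_fun_sum fun a ha => (hη a ha).differentiableAt s, sum_apply]

theorem formPd_add (hη : FormSmoothAt η x) (hθ : FormSmoothAt θ x) (i : Fin m) :
    formPd i (fun y => η y + θ y) x = formPd i η x + formPd i θ x := by
  refine forms_ext fun s => ?_
  simp only [formCoeff_formPd, map_add]
  rw [fderiv_fun_add (hη.differentiableAt s) (hθ.differentiableAt s)]
  rfl

theorem formPd_const_smul (hη : FormSmoothAt η x) (c : ℂ) (i : Fin m) :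
    formPd i (fun y => c • η y) x = c • formPd i η x := by
  refine forms_ext fun s => ?_
  simp only [formCoeff_formPd, map_smul]
  rw [fderiv_fun_const_smul (hη.differentiableAt s)]
  rfl

theorem formPd_mul (hη : FormSmoothAt η x) (hθ : FormSmoothAt θ x) (i : Fin m) :
    formPd i (fun y => η y * θ y) x = formPd i η x * θ x + η x * formPd i θ x := by
  refine forms_ext fun s => ?_
  have h : HasFDerivAt (fun y => ∑ p, ∑ q, formCoeff p (η y) * formCoeff q (θ y) *
      formCoeff s (formBasis m p * formBasis m q)) _ x :=
    HasFDerivAt.fun_sum fun p _ => HasFDerivAt.fun_sum fun q _ =>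
      ((hη.differentiableAt p).hasFDerivAt.mul (hθ.differentiableAt q).hasFDerivAt).mul_const _
  rw [map_add, formCoeff_mul, formCoeff_mul, formCoeff_formPd]
  simp only [fun y => formCoeff_mul s (η y) (θ y), formCoeff_formPd, h.fderiv,
    sum_apply, add_apply, smul_apply, ← Finset.sum_add_distrib, smul_eq_mul]
  refine Finset.sum_congr rfl fun p _ => Finset.sum_congr rfl fun q _ => ?_
  ring

theorem formPd_ofReal_smul {u : Coord m → ℝ} (hu : ContDiffAt ℝ ∞ u x) (hη : FormSmoothAt η x)
    (i : Fin m) :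
    formPd i (fun y => (u y : ℂ) • η y) x = (pd i u x : ℂ) • η x + (u x : ℂ) • formPd i η x := by
  refine forms_ext fun s => ?_
  have h : HasFDerivAt (fun y => (u y : ℂ) * formCoeff s (η y)) _ x :=
    (Complex.ofRealCLM.hasFDerivAt.comp x (hu.differentiableAt (by simp)).hasFDerivAt).mul
      (hη.differentiableAt s).hasFDerivAt
  simp only [formCoeff_formPd, map_smul, map_add, smul_eq_mul, h.fderiv]
  simp [pd]
  ring

theorem fderiv_fderiv_apply_comm {E F : Type*} [NormedAddCommGroup E] [NormedSpace ℝ E]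
    [NormedAddCommGroup F] [NormedSpace ℝ F] {f : E → F} {x : E} (hf : ContDiffAt ℝ 2 f x)
    (v w : E) :
    fderiv ℝ (fun y => fderiv ℝ f y v) x w = fderiv ℝ (fun y => fderiv ℝ f y w) x v := by
  have hd : DifferentiableAt ℝ (fderiv ℝ f) x :=
    (hf.fderiv_right (m := 1) (by norm_num)).differentiableAt (by simp)
  have key (u u' : E) : fderiv ℝ (fun y => fderiv ℝ f y u) x u' = fderiv ℝ (fderiv ℝ f) x u' u := by
    simp [fderiv_clm_apply hd (differentiableAt_const u)]
  rw [key, key]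
  exact hf.isSymmSndFDerivAt (by simp) w v

theorem formPd_formPd_comm (hη : FormSmoothAt η x) (i j : Fin m) :
    formPd i (formPd j η) x = formPd j (formPd i η) x := by
  refine forms_ext fun s => ?_
  simp only [formCoeff_formPd]
  exact fderiv_fderiv_apply_comm ((hη s).of_le ENat.LEInfty.out) _ _

theorem extD_congr (h : η =ᶠ[nhds x] θ) : extD η x = extD θ x := by
  simp only [extD_eq_sum_dx_mul_formPd, formPd_congr h]

theorem extD_const (a : Forms m) : extD (fun _ => a) x = 0 := by
  simp only [extD_eq_sum_dx_mul_formPd, formPd_const, mul_zero, Finset.sum_const_zero]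

theorem extD_sum {α : Type*} {A : Finset α} {η : α → Coord m → Forms m}
    (hη : ∀ a ∈ A, FormSmoothAt (η a) x) :
    extD (fun y => ∑ a ∈ A, η a y) x = ∑ a ∈ A, extD (η a) x := by
  simp only [extD_eq_sum_dx_mul_formPd, formPd_sum hη, Finset.mul_sum]
  exact Finset.sum_comm

theorem extD_add (hη : FormSmoothAt η x) (hθ : FormSmoothAt θ x) :
    extD (fun y => η y + θ y) x = extD η x + extD θ x := by
  simp only [extD_eq_sum_dx_mul_formPd, formPd_add hη hθ, mul_add, Finset.sum_add_distrib]

theorem extD_const_smul (hη : FormSmoothAt η x) (c : ℂ) :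
    extD (fun y => c • η y) x = c • extD η x := by
  simp only [extD_eq_sum_dx_mul_formPd, formPd_const_smul hη, Finset.smul_sum, mul_smul_comm]

theorem extD_ofReal_smul {u : Coord m → ℝ} (hu : ContDiffAt ℝ ∞ u x) (hη : FormSmoothAt η x) :
    extD (fun y => (u y : ℂ) • η y) x =
      (∑ i, (pd i u x : ℂ) • dx i) * η x + (u x : ℂ) • extD η x := by
  simp only [extD_eq_sum_dx_mul_formPd, formPd_ofReal_smul hu hη, mul_add, Finset.sum_add_distrib,
    Finset.sum_mul, mul_smul_comm, smul_mul_assoc, Finset.smul_sum]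

theorem extD_mul {p : ℕ} (hη : FormSmoothAt η x) (hθ : FormSmoothAt θ x)
    (hp : η x ∈ ⋀[ℂ]^p (Fin m → ℂ)) :
    extD (fun y => η y * θ y) x = extD η x * θ x + (-1) ^ p * (η x * extD θ x) := by
  simp only [extD_eq_sum_dx_mul_formPd, formPd_mul hη hθ, mul_add, Finset.sum_add_distrib,
    Finset.sum_mul, Finset.mul_sum, ← mul_assoc, dx_mul_of_mem_exteriorPower hp]

theorem extD_extD (hη : FormSmoothAt η x) : extD (extD η) x = 0 := by
  have hd : extD (extD η) x = ∑ i, ∑ j, dx i * dx j * formPd i (formPd j η) x := by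
    rw [funext (extD_eq_sum_dx_mul_formPd η),
      extD_sum fun j _ => (FormSmoothAt.const _).mul (hη.formPd j), Finset.sum_comm]
    refine Finset.sum_congr rfl fun j _ => ?_
    simp only [extD_eq_sum_dx_mul_formPd, formPd_mul (FormSmoothAt.const _) (hη.formPd j),
      formPd_const, zero_mul, zero_add, mul_assoc]
  have hneg : extD (extD η) x = -extD (extD η) x := by
    conv_lhs => rw [hd, Finset.sum_comm]
    simp only [hd, ← Finset.sum_neg_distrib]
    refine Finset.sum_congr rfl fun i _ => Finset.sum_congr rfl fun j _ => ?_
    rw [dx_mul_dx, neg_mul, formPd_formPd_comm hη]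
  have : IsAddTorsionFree (Forms m) := IsAddTorsionFree.of_isTorsionFree ℂ _
  exact self_eq_neg.1 hneg

variable {u : Fin m → Coord m → ℝ}

theorem FormSmoothAt.sum_ofReal_smul_dx (hu : ∀ i, ContDiffAt ℝ ∞ (u i) x) :
    FormSmoothAt (fun y => ∑ i, (u i y : ℂ) • dx i) x :=
  FormSmoothAt.sum fun i _ => FormSmoothAt.ofReal_smul (hu i) (FormSmoothAt.const _)

theorem extD_sum_ofReal_smul_dx (hu : ∀ i, ContDiffAt ℝ ∞ (u i) x) :
    extD (fun y => ∑ i, (u i y : ℂ) • dx i) x =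
      ∑ i, (∑ j, (pd j (u i) x : ℂ) • dx j) * dx i := by
  rw [extD_sum fun i _ => FormSmoothAt.ofReal_smul (hu i) (FormSmoothAt.const _)]
  simp only [extD_ofReal_smul (hu _) (FormSmoothAt.const _), extD_const, smul_zero, add_zero]

theorem extD_sum_ofReal_smul_dx_mem_exteriorPower (hu : ∀ i, ContDiffAt ℝ ∞ (u i) x) :
    extD (fun y => ∑ i, (u i y : ℂ) • dx i) x ∈ ⋀[ℂ]^2 (Fin m → ℂ) := by
  rw [extD_sum_ofReal_smul_dx hu]
  exact Submodule.sum_mem _ fun i _ =>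
    SetLike.mul_mem_graded (sum_smul_dx_mem_exteriorPower _) (dx_mem_exteriorPower i)

end FormCalculus

section RealCalculus

theorem contDiffAt_matrix_det {E ι : Type*} [NormedAddCommGroup E] [NormedSpace ℝ E] [Fintype ι]
    [DecidableEq ι] {A : E → Matrix ι ι ℝ} {x : E} {n : WithTop ℕ∞}
    (hA : ∀ a b, ContDiffAt ℝ n (fun y => A y a b) x) : ContDiffAt ℝ n (fun y => (A y).det) x := by
  simp only [Matrix.det_apply]
  exact ContDiffAt.sum fun σ _ => (contDiffAt_prod fun i _ => hA _ _).const_smul _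

theorem contDiffAt_matrix_inv {E ι : Type*} [NormedAddCommGroup E] [NormedSpace ℝ E] [Fintype ι]
    [DecidableEq ι] {A : E → Matrix ι ι ℝ} {x : E} {n : WithTop ℕ∞}
    (hA : ∀ a b, ContDiffAt ℝ n (fun y => A y a b) x) (hdet : (A x).det ≠ 0) (a b : ι) :
    ContDiffAt ℝ n (fun y => (A y)⁻¹ a b) x := by
  simp only [Matrix.inv_def, Matrix.smul_apply, Matrix.adjugate_apply, smul_eq_mul,
    Ring.inverse_eq_inv']
  refine ((contDiffAt_matrix_det hA).inv hdet).mul (contDiffAt_matrix_det fun c d => ?_)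
  rcases eq_or_ne c b with rfl | h
  · simpa only [Matrix.updateRow_self] using contDiffAt_const
  · simpa only [Matrix.updateRow_ne h] using hA c d

variable {n k : ℕ}

theorem contDiffAt_pd {u : Coord n → ℝ} {x : Coord n} (hu : ContDiffAt ℝ ∞ u x) (i : Fin n) :
    ContDiffAt ℝ ∞ (pd i u) x :=
  (hu.fderiv_right (by simp)).clm_apply contDiffAt_const

theorem pd_eq_zero_of_eventually_eq_const {u : Coord n → ℝ} {x : Coord n} {c : ℝ}
    (hu : ∀ᶠ y in nhds x, u y = c) (i : Fin n) : pd i u x = 0 := by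
  have huc : u =ᶠ[nhds x] fun _ => c := hu
  simp [pd, huc.fderiv_eq]

theorem pd_pd_comm {u : Coord n → ℝ} {x : Coord n} (hu : ContDiffAt ℝ ∞ u x) (i j : Fin n) :
    pd i (pd j u) x = pd j (pd i u) x :=
  fderiv_fderiv_apply_comm (hu.of_le ENat.LEInfty.out) _ _

theorem fderiv_apply_single_apply {f : Coord n → Coord k} {x : Coord n}
    (hf : DifferentiableAt ℝ f x) (i : Fin n) (c : Fin k) :
    fderiv ℝ f x (EuclideanSpace.single i 1) c = pd i (fun y => f y c) x := by
  have h : HasFDerivAt (fun y => f y c) _ x :=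
    (EuclideanSpace.proj (𝕜 := ℝ) c).hasFDerivAt.comp x hf.hasFDerivAt
  rw [pd, h.fderiv]
  rfl

theorem fderiv_eq_sum_pd (u : Coord n → ℝ) (x v : Coord n) :
    fderiv ℝ u x v = ∑ e, pd e u x * v e := by
  conv_lhs => rw [← (EuclideanSpace.basisFun (Fin n) ℝ).sum_repr v, map_sum]
  simp [pd, mul_comm]

theorem pd_comp {u : Coord k → ℝ} {f : Coord n → Coord k} {x : Coord n}
    (hu : DifferentiableAt ℝ u (f x)) (hf : DifferentiableAt ℝ f x) (i : Fin n) :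
    pd i (fun y => u (f y)) x = ∑ e, pd e u (f x) * pd i (fun y => f y e) x := by
  have h : HasFDerivAt (fun y => u (f y)) _ x := hu.hasFDerivAt.comp x hf.hasFDerivAt
  rw [pd, h.fderiv, ContinuousLinearMap.comp_apply, fderiv_eq_sum_pd]
  simp only [fderiv_apply_single_apply hf]

open Matrix in
theorem pd_dotProduct_mulVec {ι : Type*} [Fintype ι] {A : Coord n → Matrix ι ι ℝ}
    {s t : Coord n → ι → ℝ} {x : Coord n}
    (hA : ∀ a b, DifferentiableAt ℝ (fun y => A y a b) x)
    (hs : ∀ a, DifferentiableAt ℝ (fun y => s y a) x)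
    (ht : ∀ a, DifferentiableAt ℝ (fun y => t y a) x) (i : Fin n) :
    pd i (fun y => s y ⬝ᵥ A y *ᵥ t y) x =
      (fun a => pd i (fun y => s y a) x) ⬝ᵥ A x *ᵥ t x +
      s x ⬝ᵥ (Matrix.of fun a b => pd i (fun y => A y a b) x) *ᵥ t x +
      s x ⬝ᵥ A x *ᵥ (fun a => pd i (fun y => t y a) x) := by
  have h : HasFDerivAt (fun y => s y ⬝ᵥ A y *ᵥ t y) _ x :=
    HasFDerivAt.fun_sum fun a _ => (hs a).hasFDerivAt.mul <|
      HasFDerivAt.fun_sum fun b _ => (hA a b).hasFDerivAt.mul (ht b).hasFDerivAt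
  rw [pd, h.fderiv]
  simp only [dotProduct, mulVec, pd, _root_.sum_apply, _root_.add_apply, _root_.smul_apply,
    smul_eq_mul, of_apply, Finset.sum_add_distrib, mul_add, mul_comm]
  abel

end RealCalculus

section Christoffel

variable {n : ℕ} {y : Coord n} {G : Coord n → Matrix (Fin n) (Fin n) ℝ}

theorem contDiffAt_christoffel (hG : ∀ a b, ContDiffAt ℝ ∞ (fun z => G z a b) y)
    (hdet : (G y).det ≠ 0) (c a b : Fin n) :
    ContDiffAt ℝ ∞ (fun z => christoffel G z c a b) y := by
  refine contDiffAt_const.mul (ContDiffAt.sum fun d _ =>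
    (contDiffAt_matrix_inv hG hdet c d).mul ?_)
  exact ((contDiffAt_pd (hG _ _) _).add (contDiffAt_pd (hG _ _) _)).sub (contDiffAt_pd (hG _ _) _)

theorem christoffel_comm (hG : ∀ z, (G z).IsSymm) (c a b : Fin n) :
    christoffel G y c a b = christoffel G y c b a := by
  simp only [christoffel, fun z => (hG z).apply a b]
  congr 1
  exact Finset.sum_congr rfl fun d _ => by ring

theorem sum_metric_mul_christoffel (hdet : (G y).det ≠ 0) (e a b : Fin n) :
    ∑ c, G y e c * christoffel G y c a b =
      1 / 2 * (pd a (fun z => G z b e) y + pd b (fun z => G z a e) y -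
        pd e (fun z => G z a b) y) := by
  set K : Fin n → ℝ := fun d =>
    pd a (fun z => G z b d) y + pd b (fun z => G z a d) y - pd d (fun z => G z a b) y
  have hΓ : (fun c => christoffel G y c a b) = (1 / 2 : ℝ) • (G y)⁻¹.mulVec K := rfl
  have hGΓ : (G y).mulVec (fun c => christoffel G y c a b) = (1 / 2 : ℝ) • K := by
    rw [hΓ, Matrix.mulVec_smul, Matrix.mulVec_mulVec, Matrix.mul_nonsing_inv _ hdet.isUnit,
      Matrix.one_mulVec]
  exact congrFun hGΓ e

theorem pd_metric_eq_sum_christoffel (hG : ∀ z, (G z).IsSymm) (hdet : (G y).det ≠ 0)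
    (e a b : Fin n) :
    pd e (fun z => G z a b) y =
      ∑ c, G y b c * christoffel G y c e a + ∑ c, G y a c * christoffel G y c e b := by
  simp only [sum_metric_mul_christoffel hdet, fun z => (hG z).apply a b]
  ring

end Christoffel

namespace Patch

variable {m : ℕ}

section InnerProduct

variable (P : Patch m)

/-- The inner product of the outer manifold at the point `f x`. -/
def ip (x : Coord m) : LinearMap.BilinForm ℝ (Fin (m + 1) → ℝ) := Matrix.toBilin' (P.G (P.f x))

theorem ip_eq_dotProduct (x : Coord m) (u w : Fin (m + 1) → ℝ) :
    P.ip x u w = u ⬝ᵥ (P.G (P.f x)).mulVec w :=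
  Matrix.toBilin'_apply' _ _ _

theorem ip_eq_sum (x : Coord m) (u w : Fin (m + 1) → ℝ) :
    P.ip x u w = ∑ a, ∑ b, P.G (P.f x) a b * u a * w b := by
  rw [ip, Matrix.toBilin'_apply]
  exact Finset.sum_congr rfl fun a _ => Finset.sum_congr rfl fun b _ => by ring

theorem metric_eq_ip (x : Coord m) (i j : Fin m) :
    P.metric x i j = P.ip x (P.tangent i x) (P.tangent j x) :=
  (P.ip_eq_sum x _ _).symm

theorem secondFF_eq_ip (x : Coord m) (i j : Fin m) :
    P.secondFF x i j = P.ip x (P.covOut i (P.tangent j) x) (P.N x) :=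
  (P.ip_eq_sum x _ _).symm

/-- The coefficient matrix `Θᵢ` of the restricted outer connection in the coordinates of the outer
manifold: `∇^out_{∂ᵢ} s = ∂ᵢ s + Θᵢ s`. -/
def pullbackChristoffel (i : Fin m) (x : Coord m) : Matrix (Fin (m + 1)) (Fin (m + 1)) ℝ :=
  Matrix.of fun c b => ∑ a, christoffel P.G (P.f x) c a b * P.tangent i x a

theorem covOut_eq_add_mulVec (i : Fin m) (s : Coord m → Fin (m + 1) → ℝ) (x : Coord m) :
    P.covOut i s x =
      (fun c => pd i (fun y => s y c) x) + (P.pullbackChristoffel i x).mulVec (s x) := by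
  ext c
  simp only [covOut, Pi.add_apply, Matrix.mulVec, dotProduct, pullbackChristoffel, Matrix.of_apply,
    Finset.sum_mul]
  rw [Finset.sum_comm]

end InnerProduct

/-- The coordinate expression `P` describes, over the open set `W`, a smooth hypersurface immersed
in a Riemannian manifold together with a smooth unit normal field. -/
structure IsRegularOn (P : Patch m) (W : Set (Coord m)) : Prop where
  isOpen : IsOpen W
  smooth_G : ∀ x ∈ W, ∀ a b, ContDiffAt ℝ ∞ (fun y => P.G y a b) (P.f x)
  smooth_f : ∀ x ∈ W, ContDiffAt ℝ ∞ P.f x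
  smooth_N : ∀ x ∈ W, ∀ c, ContDiffAt ℝ ∞ (fun y => P.N y c) x
  symm : ∀ y, (P.G y).IsSymm
  posDef : ∀ x ∈ W, (P.G (P.f x)).PosDef
  unit : ∀ x ∈ W, P.ip x (P.N x) (P.N x) = 1
  orth : ∀ x ∈ W, ∀ i, P.ip x (P.tangent i x) (P.N x) = 0
  indep : ∀ x ∈ W, LinearIndependent ℝ fun i => P.tangent i x

namespace IsRegularOn

variable {P : Patch m} {W : Set (Coord m)} {x : Coord m}

section Metric

theorem ip_comm (h : P.IsRegularOn W) (u w : Fin (m + 1) → ℝ) : P.ip x u w = P.ip x w u := by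
  rw [ip_eq_dotProduct, ip_eq_dotProduct, Matrix.dotProduct_mulVec, dotProduct_comm,
    ← Matrix.mulVec_transpose, (h.symm _).eq]

theorem ip_self_pos (h : P.IsRegularOn W) (hx : x ∈ W) {u : Fin (m + 1) → ℝ} (hu : u ≠ 0) :
    0 < P.ip x u u := by
  rw [ip_eq_dotProduct]
  exact (h.posDef x hx).dotProduct_mulVec_pos hu

theorem metric_isSymm (h : P.IsRegularOn W) (y : Coord m) : (P.metric y).IsSymm := by
  ext i j
  rw [Matrix.transpose_apply, metric_eq_ip, metric_eq_ip, h.ip_comm]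

theorem metric_posDef (h : P.IsRegularOn W) (hx : x ∈ W) : (P.metric x).PosDef := by
  set T : Matrix (Fin m) (Fin (m + 1)) ℝ := Matrix.of fun i => P.tangent i x
  have hT : P.metric x = T * P.G (P.f x) * T.conjTranspose := by
    ext i j
    simp only [metric_eq_ip, ip_eq_dotProduct, Matrix.mul_assoc]
    rfl
  rw [hT]
  exact (h.posDef x hx).mul_mul_conjTranspose_same (Matrix.vecMul_injective_iff.2 (h.indep x hx))

theorem det_G_ne_zero (h : P.IsRegularOn W) (hx : x ∈ W) : (P.G (P.f x)).det ≠ 0 :=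
  (h.posDef x hx).det_pos.ne'

theorem det_metric_ne_zero (h : P.IsRegularOn W) (hx : x ∈ W) : (P.metric x).det ≠ 0 :=
  (h.metric_posDef hx).det_pos.ne'

theorem metric_mulVec_weingarten (h : P.IsRegularOn W) (hx : x ∈ W) (i : Fin m) :
    (P.metric x).mulVec (fun k => P.weingarten x k i) = P.secondFF x i := by
  have hII : (fun k => P.weingarten x k i) = (P.metric x)⁻¹.mulVec (P.secondFF x i) := rfl
  rw [hII, Matrix.mulVec_mulVec, Matrix.mul_nonsing_inv _ (h.det_metric_ne_zero hx).isUnit,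
    Matrix.one_mulVec]

theorem linearIndependent_frame (h : P.IsRegularOn W) (hx : x ∈ W) :
    LinearIndependent ℝ fun α => P.frame α x := by
  rw [Fintype.linearIndependent_iff]
  intro c hc
  simp only [Fintype.sum_sum_type, frame, Finset.univ_unique, Finset.sum_singleton] at hc
  have hN : c (Sum.inr default) = 0 := by
    simpa [h.orth x hx, h.unit x hx] using congrArg (fun v => P.ip x v (P.N x)) hc
  rw [hN, zero_smul, add_zero] at hc
  rintro (i | _)
  · exact Fintype.linearIndependent_iff.1 (h.indep x hx) _ hc i
  · exact hN

theorem eq_of_ip_frame_eq (h : P.IsRegularOn W) (hx : x ∈ W) {u w : Fin (m + 1) → ℝ}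
    (huw : ∀ α, P.ip x u (P.frame α x) = P.ip x w (P.frame α x)) : u = w := by
  have hspan := (h.linearIndependent_frame hx).span_eq_top_of_card_eq_finrank' (by simp)
  have hker : P.ip x (u - w) = 0 := by
    refine LinearMap.ext_on_range (v := fun α => P.frame α x) hspan fun α => ?_
    rw [map_sub, LinearMap.sub_apply, huw, sub_self, LinearMap.zero_apply]
  by_contra hne
  exact (h.ip_self_pos hx (sub_ne_zero.2 hne)).ne' (by rw [hker, LinearMap.zero_apply])

end Metric

section Smoothness

theorem contDiffAt_tangent (h : P.IsRegularOn W) (hx : x ∈ W) (i : Fin m) (c : Fin (m + 1)) :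
    ContDiffAt ℝ ∞ (fun y => P.tangent i y c) x :=
  contDiffAt_pd ((EuclideanSpace.proj (𝕜 := ℝ) c).contDiff.contDiffAt.comp x (h.smooth_f x hx)) i

theorem contDiffAt_G_comp_f (h : P.IsRegularOn W) (hx : x ∈ W) (a b : Fin (m + 1)) :
    ContDiffAt ℝ ∞ (fun y => P.G (P.f y) a b) x :=
  (h.smooth_G x hx a b).comp x (h.smooth_f x hx)

theorem contDiffAt_christoffel_comp_f (h : P.IsRegularOn W) (hx : x ∈ W) (c a b : Fin (m + 1)) :
    ContDiffAt ℝ ∞ (fun y => christoffel P.G (P.f y) c a b) x :=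
  (contDiffAt_christoffel (h.smooth_G x hx) (h.det_G_ne_zero hx) c a b).comp x (h.smooth_f x hx)

theorem contDiffAt_ip (h : P.IsRegularOn W) (hx : x ∈ W) {s t : Coord m → Fin (m + 1) → ℝ}
    (hs : ∀ c, ContDiffAt ℝ ∞ (fun y => s y c) x) (ht : ∀ c, ContDiffAt ℝ ∞ (fun y => t y c) x) :
    ContDiffAt ℝ ∞ (fun y => P.ip y (s y) (t y)) x := by
  simp only [ip_eq_sum]
  exact ContDiffAt.sum fun a _ => ContDiffAt.sum fun b _ =>
    ((h.contDiffAt_G_comp_f hx a b).mul (hs a)).mul (ht b)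

theorem contDiffAt_metric (h : P.IsRegularOn W) (hx : x ∈ W) (i j : Fin m) :
    ContDiffAt ℝ ∞ (fun y => P.metric y i j) x := by
  simp only [metric_eq_ip]
  exact h.contDiffAt_ip hx (h.contDiffAt_tangent hx i) (h.contDiffAt_tangent hx j)

theorem contDiffAt_christoffel_metric (h : P.IsRegularOn W) (hx : x ∈ W) (k i j : Fin m) :
    ContDiffAt ℝ ∞ (fun y => christoffel P.metric y k i j) x :=
  contDiffAt_christoffel (h.contDiffAt_metric hx) (h.det_metric_ne_zero hx) k i j

theorem contDiffAt_covOut (h : P.IsRegularOn W) (hx : x ∈ W) {s : Coord m → Fin (m + 1) → ℝ}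
    (hs : ∀ c, ContDiffAt ℝ ∞ (fun y => s y c) x) (i : Fin m) (c : Fin (m + 1)) :
    ContDiffAt ℝ ∞ (fun y => P.covOut i s y c) x :=
  (contDiffAt_pd (hs c) i).add <| ContDiffAt.sum fun a _ => ContDiffAt.sum fun b _ =>
    ((h.contDiffAt_christoffel_comp_f hx c a b).mul (h.contDiffAt_tangent hx i a)).mul (hs b)

theorem contDiffAt_secondFF (h : P.IsRegularOn W) (hx : x ∈ W) (i j : Fin m) :
    ContDiffAt ℝ ∞ (fun y => P.secondFF y i j) x := by
  simp only [secondFF_eq_ip]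
  exact h.contDiffAt_ip hx (h.contDiffAt_covOut hx (h.contDiffAt_tangent hx j) i)
    (h.smooth_N x hx)

theorem contDiffAt_weingarten (h : P.IsRegularOn W) (hx : x ∈ W) (k i : Fin m) :
    ContDiffAt ℝ ∞ (fun y => P.weingarten y k i) x :=
  ContDiffAt.sum fun j _ => (contDiffAt_matrix_inv (h.contDiffAt_metric hx)
    (h.det_metric_ne_zero hx) k j).mul (h.contDiffAt_secondFF hx i j)

end Smoothness

section GaussWeingarten

theorem pd_G_comp_f (h : P.IsRegularOn W) (hx : x ∈ W) (i : Fin m) :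
    (Matrix.of fun a b => pd i (fun y => P.G (P.f y) a b) x) =
      (P.pullbackChristoffel i x).transpose * P.G (P.f x) +
        P.G (P.f x) * P.pullbackChristoffel i x := by
  ext a b
  rw [Matrix.of_apply, pd_comp ((h.smooth_G x hx a b).differentiableAt (by simp))
    ((h.smooth_f x hx).differentiableAt (by simp))]
  simp only [pd_metric_eq_sum_christoffel h.symm (h.det_G_ne_zero hx), add_mul,
    Finset.sum_add_distrib, Matrix.add_apply, Matrix.mul_apply, Matrix.transpose_apply,
    pullbackChristoffel, Matrix.of_apply, Finset.sum_mul, Finset.mul_sum]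
  congr 1 <;> rw [Finset.sum_comm] <;>
    refine Finset.sum_congr rfl fun c _ => Finset.sum_congr rfl fun e _ => ?_
  · rw [tangent, (h.symm _).apply c b]
    ring
  · rw [tangent]
    ring

theorem pd_ip (h : P.IsRegularOn W) (hx : x ∈ W) {s t : Coord m → Fin (m + 1) → ℝ}
    (hs : ∀ c, ContDiffAt ℝ ∞ (fun y => s y c) x) (ht : ∀ c, ContDiffAt ℝ ∞ (fun y => t y c) x)
    (i : Fin m) :
    pd i (fun y => P.ip y (s y) (t y)) x =
      P.ip x (P.covOut i s x) (t x) + P.ip x (s x) (P.covOut i t x) := by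
  simp only [ip_eq_dotProduct]
  rw [pd_dotProduct_mulVec
    (fun a b => (h.contDiffAt_G_comp_f hx a b).differentiableAt (by simp))
    (fun a => (hs a).differentiableAt (by simp)) (fun a => (ht a).differentiableAt (by simp)),
    h.pd_G_comp_f hx, covOut_eq_add_mulVec, covOut_eq_add_mulVec, Matrix.add_mulVec,
    dotProduct_add, ← Matrix.mulVec_mulVec, Matrix.dotProduct_mulVec (s x) (Matrix.transpose _),
    Matrix.vecMul_transpose, add_dotProduct, Matrix.mulVec_add, dotProduct_add,
    Matrix.mulVec_mulVec]
  ring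

theorem covOut_tangent_comm (h : P.IsRegularOn W) (hx : x ∈ W) (i j : Fin m) :
    P.covOut i (P.tangent j) x = P.covOut j (P.tangent i) x := by
  ext c
  have hf : ContDiffAt ℝ ∞ (fun y => P.f y c) x :=
    (EuclideanSpace.proj (𝕜 := ℝ) c).contDiff.contDiffAt.comp x (h.smooth_f x hx)
  refine congrArg₂ (· + ·) (pd_pd_comm hf i j) ?_
  rw [Finset.sum_comm]
  refine Finset.sum_congr rfl fun a _ => Finset.sum_congr rfl fun b _ => ?_
  rw [christoffel_comm h.symm, mul_right_comm]

theorem pd_metric (h : P.IsRegularOn W) (hx : x ∈ W) (i j k : Fin m) :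
    pd i (fun y => P.metric y j k) x = P.ip x (P.covOut i (P.tangent j) x) (P.tangent k x) +
      P.ip x (P.covOut i (P.tangent k) x) (P.tangent j x) := by
  simp only [metric_eq_ip]
  rw [h.pd_ip hx (h.contDiffAt_tangent hx j) (h.contDiffAt_tangent hx k),
    h.ip_comm (P.tangent j x)]

theorem ip_covOut_tangent_tangent (h : P.IsRegularOn W) (hx : x ∈ W) (i j l : Fin m) :
    P.ip x (P.covOut i (P.tangent j) x) (P.tangent l x) =
      ∑ k, P.metric x l k * christoffel P.metric x k i j := by
  rw [sum_metric_mul_christoffel (h.det_metric_ne_zero hx), h.pd_metric hx, h.pd_metric hx,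
    h.pd_metric hx, h.covOut_tangent_comm hx j i, h.covOut_tangent_comm hx l i,
    h.covOut_tangent_comm hx l j]
  ring

theorem ip_covOut_N_tangent (h : P.IsRegularOn W) (hx : x ∈ W) (i l : Fin m) :
    P.ip x (P.covOut i P.N x) (P.tangent l x) = -P.secondFF x i l := by
  have horth : pd i (fun y => P.ip y (P.tangent l y) (P.N y)) x = 0 :=
    pd_eq_zero_of_eventually_eq_const
      (Filter.eventually_of_mem (h.isOpen.mem_nhds hx) fun y hy => h.orth y hy l) i
  rw [h.pd_ip hx (h.contDiffAt_tangent hx l) (h.smooth_N x hx), ← secondFF_eq_ip] at horth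
  rw [h.ip_comm]
  linarith

theorem ip_covOut_N_N (h : P.IsRegularOn W) (hx : x ∈ W) (i : Fin m) :
    P.ip x (P.covOut i P.N x) (P.N x) = 0 := by
  have hunit : pd i (fun y => P.ip y (P.N y) (P.N y)) x = 0 :=
    pd_eq_zero_of_eventually_eq_const
      (Filter.eventually_of_mem (h.isOpen.mem_nhds hx) fun y hy => h.unit y hy) i
  rw [h.pd_ip hx (h.smooth_N x hx) (h.smooth_N x hx), h.ip_comm (P.N x)] at hunit
  linarith

theorem covOut_tangent (h : P.IsRegularOn W) (hx : x ∈ W) (i j : Fin m) :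
    P.covOut i (P.tangent j) x =
      ∑ k, christoffel P.metric x k i j • P.tangent k x + P.secondFF x i j • P.N x := by
  refine h.eq_of_ip_frame_eq hx ?_
  rintro (l | _) <;>
    simp only [frame, map_add, map_sum, map_smul, LinearMap.add_apply, LinearMap.sum_apply,
      LinearMap.smul_apply, smul_eq_mul]
  · simp only [h.ip_covOut_tangent_tangent hx, h.ip_comm (P.N x), h.orth x hx, ← metric_eq_ip,
      zero_mul, add_zero, mul_comm, (h.metric_isSymm x).apply]
  · simp only [h.unit x hx, h.orth x hx, ← secondFF_eq_ip, mul_zero, mul_one,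
      Finset.sum_const_zero, zero_add]

theorem covOut_N (h : P.IsRegularOn W) (hx : x ∈ W) (i : Fin m) :
    P.covOut i P.N x = -∑ k, P.weingarten x k i • P.tangent k x := by
  refine h.eq_of_ip_frame_eq hx ?_
  rintro (l | _) <;>
    simp only [frame, map_neg, map_sum, map_smul, LinearMap.neg_apply, LinearMap.sum_apply,
      LinearMap.smul_apply, smul_eq_mul]
  · rw [h.ip_covOut_N_tangent hx, ← h.metric_mulVec_weingarten hx]
    simp only [← metric_eq_ip, Matrix.mulVec, dotProduct, mul_comm, (h.metric_isSymm x).apply]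
  · simp only [h.ip_covOut_N_N hx, h.orth x hx, mul_zero, Finset.sum_const_zero, neg_zero]

theorem isOuterConnectionMatrix (h : P.IsRegularOn W) (hx : x ∈ W) :
    P.IsOuterConnectionMatrix (P.nablaT 1 x) x := by
  rintro (j | _) c <;>
    simp only [Fintype.sum_sum_type, frame, nablaT, nabla, wedgeN, Matrix.add_apply,
      Matrix.fromBlocks_apply₁₁, Matrix.fromBlocks_apply₁₂,
      Matrix.fromBlocks_apply₂₁, Matrix.fromBlocks_apply₂₂, Matrix.zero_apply, Matrix.of_apply,
      Complex.ofReal_one, one_smul, add_zero, zero_add, smul_zero, Finset.sum_const_zero,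
      Finset.univ_unique, Finset.sum_singleton]
  · have hGauss : ∀ i, (P.covOut i (P.tangent j) x c : ℂ) =
        ∑ k, (P.tangent k x c : ℂ) * (christoffel P.metric x k i j : ℂ) +
          (P.N x c : ℂ) * (P.secondFF x i j : ℂ) := fun i => by
      simp [h.covOut_tangent hx, mul_comm]
    simp only [hGauss, leviCivita, covecII, Matrix.of_apply, Finset.smul_sum, smul_smul, add_smul,
      Finset.sum_add_distrib, Finset.sum_smul]
    rw [Finset.sum_comm]
  · have hWeingarten : ∀ i, (P.covOut i P.N x c : ℂ) =
        -∑ k, (P.tangent k x c : ℂ) * (P.weingarten x k i : ℂ) := fun i => by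
      simp [h.covOut_N hx, mul_comm]
    simp only [hWeingarten, vecII, Finset.smul_sum, smul_smul, neg_smul, smul_neg,
      Finset.sum_neg_distrib, Finset.sum_smul]
    rw [Finset.sum_comm]

end GaussWeingarten

end IsRegularOn

end Patch

section BlockPowers

open scoped RightActions

open Matrix (vecMulVec replicateCol replicateRow)

variable {κ 𝕜 A : Type*} [CommRing 𝕜] [Ring A] [Algebra 𝕜 A]

/-- The block matrix shape of the curvature of `∇ + t II ∧ N` with respect to a frame
`(∂₁, …, ∂ₘ, N)`: `R` stands for the curvature of `∇`, `v` and `b` for `II` with values in `TM` and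
in its dual, `w` and `c` for `d^∇ II` with values in `TM` and in its dual. -/
def curvBlock (R : Matrix κ κ A) (v b w c : κ → A) (t : 𝕜) : Matrix (κ ⊕ Unit) (κ ⊕ Unit) A :=
  Matrix.fromBlocks (R - t ^ 2 • vecMulVec v b) (-(t • replicateCol Unit w))
    (t • replicateRow Unit c) 0

/-- The block matrix shape of `II ∧ N`: `v` and `b` stand for `II` with values in `TM` and in its
dual. -/
def velBlock (v b : κ → A) : Matrix (κ ⊕ Unit) (κ ⊕ Unit) A :=
  Matrix.fromBlocks 0 (-replicateCol Unit v) (replicateRow Unit b) 0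

variable [Fintype κ] {R : Matrix κ κ A} {v b w c : κ → A} {t : 𝕜}

theorem curvBlock_mulVec_elim (u : κ → A) (z : A) :
    (curvBlock R v b w c t).mulVec (Sum.elim u fun _ => z) =
      Sum.elim (R.mulVec u - t ^ 2 • (v <• (b ⬝ᵥ u)) - t • (w <• z)) fun _ => t • (c ⬝ᵥ u) := by
  have hw : (replicateCol Unit w).mulVec (fun _ => z) = w <• z := by
    ext i
    simp [Matrix.mulVec, dotProduct]
  rw [curvBlock, Matrix.fromBlocks_mulVec, Sum.elim_comp_inl, Sum.elim_comp_inr, Matrix.sub_mulVec,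
    Matrix.smul_mulVec, Matrix.vecMulVec_mulVec, Matrix.neg_mulVec, Matrix.smul_mulVec, hw,
    Matrix.zero_mulVec, add_zero, Matrix.smul_mulVec, sub_eq_add_neg (_ - _)]
  rfl

theorem curvBlock_mulVec_normal :
    (curvBlock R v b w c t).mulVec (Sum.elim 0 1) = Sum.elim (-(t • w)) 0 := by
  rw [show (1 : Unit → A) = fun _ => 1 from rfl, curvBlock_mulVec_elim]
  ext (i | i) <;> simp

theorem curvBlock_mulVec_mulVec_normal (hRw : R.mulVec w = 0) :
    (curvBlock R v b w c t).mulVec ((curvBlock R v b w c t).mulVec (Sum.elim 0 1)) =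
      Sum.elim (t ^ 3 • (v <• (b ⬝ᵥ w))) fun _ => -t ^ 2 • (c ⬝ᵥ w) := by
  rw [curvBlock_mulVec_normal, show (0 : Unit → A) = fun _ => 0 from rfl, curvBlock_mulVec_elim,
    Matrix.mulVec_neg, Matrix.mulVec_smul, hRw]
  ext (i | i)
  · simp [smul_smul, pow_succ]
  · simp [smul_smul, pow_two]

theorem curvBlock_mulVec_tangential (hRv : R.mulVec v = 0) (hbv : b ⬝ᵥ v = 0) :
    (curvBlock R v b w c t).mulVec (Sum.elim v 0) =
      (Sum.elim 0 1 : κ ⊕ Unit → A) <• (t • (c ⬝ᵥ v)) := by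
  rw [show (0 : Unit → A) = fun _ => 0 from rfl, curvBlock_mulVec_elim, hRv, hbv]
  ext (i | i) <;> simp

theorem trace_velBlock_mul (v b : κ → A) (B : Matrix (κ ⊕ Unit) (κ ⊕ Unit) A) :
    (velBlock v b * B).trace =
      ∑ j, b j * B (Sum.inl j) (Sum.inr ()) - ∑ i, v i * B (Sum.inr ()) (Sum.inl i) := by
  simp [Matrix.trace, Matrix.mul_apply, velBlock, sub_eq_neg_add]

variable [DecidableEq κ]

theorem curvBlock_pow_odd_mulVec_normal (hRv : R.mulVec v = 0) (hRw : R.mulVec w = 0)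
    (hbv : b ⬝ᵥ v = 0) (hcv : c ⬝ᵥ v = b ⬝ᵥ w) (hbw : (b ⬝ᵥ w) * (b ⬝ᵥ w) = 0) (k : ℕ) :
    (curvBlock R v b w c t ^ (2 * k + 1)).mulVec (Sum.elim 0 1) =
      Sum.elim (-(t • w)) 0 <• (-t ^ 2 • (c ⬝ᵥ w)) ^ k := by
  set B := curvBlock R v b w c t
  set e : κ ⊕ Unit → A := Sum.elim 0 1
  have hsq : B.mulVec (B.mulVec e) =
      e <• (-t ^ 2 • (c ⬝ᵥ w)) + t ^ 3 • (Sum.elim v 0 <• (b ⬝ᵥ w)) := by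
    rw [curvBlock_mulVec_mulVec_normal hRw]
    ext (i | i) <;> simp [e]
  have hcube : B.mulVec (B.mulVec (B.mulVec e)) = B.mulVec e <• (-t ^ 2 • (c ⬝ᵥ w)) := by
    rw [hsq, Matrix.mulVec_add, Matrix.mulVec_smul, Matrix.mulVec_smul, Matrix.mulVec_smul,
      curvBlock_mulVec_tangential hRv hbv, hcv, smul_smul, ← MulOpposite.op_mul, smul_mul_assoc,
      hbw, smul_zero, MulOpposite.op_zero, zero_smul, smul_zero, add_zero]
  rw [← curvBlock_mulVec_normal (R := R) (v := v) (b := b) (c := c)]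
  induction k with
  | zero => simp [B, e]
  | succ k ih =>
    rw [show 2 * (k + 1) + 1 = 2 + (2 * k + 1) by ring, pow_add, ← Matrix.mulVec_mulVec, ih,
      Matrix.mulVec_smul, pow_two B, ← Matrix.mulVec_mulVec, hcube, smul_smul, ← MulOpposite.op_mul,
      ← pow_succ']

theorem curvBlock_pow_even_apply_normal (hRv : R.mulVec v = 0) (hRw : R.mulVec w = 0)
    (hbv : b ⬝ᵥ v = 0) (hcv : c ⬝ᵥ v = b ⬝ᵥ w) (hbw : (b ⬝ᵥ w) * (b ⬝ᵥ w) = 0) (k : ℕ) :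
    (curvBlock R v b w c t ^ (2 * k)).mulVec (Sum.elim 0 1) (Sum.inr ()) =
      (-t ^ 2 • (c ⬝ᵥ w)) ^ k := by
  cases k with
  | zero => simp
  | succ k =>
    rw [show 2 * (k + 1) = (2 * k + 1) + 1 by ring, pow_succ', ← Matrix.mulVec_mulVec,
      curvBlock_pow_odd_mulVec_normal hRv hRw hbv hcv hbw, Matrix.mulVec_smul,
      ← curvBlock_mulVec_normal (R := R) (v := v) (b := b) (c := c),
      curvBlock_mulVec_mulVec_normal hRw, pow_succ' (-t ^ 2 • (c ⬝ᵥ w))]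
    rfl

theorem dotProduct_curvBlock_pow_odd_normal (hRv : R.mulVec v = 0) (hRw : R.mulVec w = 0)
    (hbv : b ⬝ᵥ v = 0) (hcv : c ⬝ᵥ v = b ⬝ᵥ w) (hbw : (b ⬝ᵥ w) * (b ⬝ᵥ w) = 0) (k : ℕ) :
    ∑ j, b j * (curvBlock R v b w c t ^ (2 * k + 1)) (Sum.inl j) (Sum.inr ()) =
      -(t • ((b ⬝ᵥ w) * (-t ^ 2 • (c ⬝ᵥ w)) ^ k)) := by
  have hcol : ∀ j, (curvBlock R v b w c t ^ (2 * k + 1)) (Sum.inl j) (Sum.inr ()) =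
      -(t • (w j * (-t ^ 2 • (c ⬝ᵥ w)) ^ k)) := fun j => by
    simpa [Matrix.mulVec, dotProduct] using
      congrFun (curvBlock_pow_odd_mulVec_normal (t := t) hRv hRw hbv hcv hbw k) (Sum.inl j)
  simp only [hcol, mul_neg, mul_smul_comm, Finset.sum_neg_distrib, ← Finset.smul_sum, dotProduct,
    Finset.sum_mul, mul_assoc]

theorem curvBlock_pow_odd_normal_dotProduct (hRv : R.mulVec v = 0) (hRw : R.mulVec w = 0)
    (hbv : b ⬝ᵥ v = 0) (hcv : c ⬝ᵥ v = b ⬝ᵥ w) (hbw : (b ⬝ᵥ w) * (b ⬝ᵥ w) = 0) (k : ℕ) :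
    ∑ i, (curvBlock R v b w c t ^ (2 * k + 1)) (Sum.inr ()) (Sum.inl i) * v i =
      t • ((-t ^ 2 • (c ⬝ᵥ w)) ^ k * (b ⬝ᵥ w)) := by
  have hrow : (curvBlock R v b w c t ^ (2 * k + 1)).mulVec (Sum.elim v 0) (Sum.inr ()) =
      (-t ^ 2 • (c ⬝ᵥ w)) ^ k * (t • (b ⬝ᵥ w)) := by
    rw [pow_succ, ← Matrix.mulVec_mulVec, curvBlock_mulVec_tangential hRv hbv, Matrix.mulVec_smul,
      hcv, Pi.smul_apply, curvBlock_pow_even_apply_normal hRv hRw hbv hcv hbw, op_smul_eq_mul]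
  rw [← mul_smul_comm, ← hrow]
  simp [Matrix.mulVec, dotProduct]

theorem curvBlock_pow_apply_mem_center (hR : ∀ i j, R i j ∈ Subalgebra.center 𝕜 A)
    (hvb : ∀ i j, v i * b j ∈ Subalgebra.center 𝕜 A) (hw : ∀ i, w i ∈ Subalgebra.center 𝕜 A)
    (hc : ∀ i, c i ∈ Subalgebra.center 𝕜 A) (n : ℕ) (i j : κ ⊕ Unit) :
    (curvBlock R v b w c t ^ n) i j ∈ Subalgebra.center 𝕜 A := by
  have hB : curvBlock R v b w c t ∈ (Subalgebra.center 𝕜 A).matrix := by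
    rintro (i | i) (j | j)
    · exact Subalgebra.sub_mem _ (hR i j) (Subalgebra.smul_mem _ (hvb i j) _)
    · exact Subalgebra.neg_mem _ (Subalgebra.smul_mem _ (hw i) _)
    · exact Subalgebra.smul_mem _ (hc j) _
    · exact zero_mem _
  exact pow_mem hB n i j

theorem trace_velBlock_mul_curvBlock_pow (hR : ∀ i j, R i j ∈ Subalgebra.center 𝕜 A)
    (hvb : ∀ i j, v i * b j ∈ Subalgebra.center 𝕜 A) (hw : ∀ i, w i ∈ Subalgebra.center 𝕜 A)
    (hc : ∀ i, c i ∈ Subalgebra.center 𝕜 A) (hRv : R.mulVec v = 0) (hRw : R.mulVec w = 0)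
    (hbv : b ⬝ᵥ v = 0) (hcv : c ⬝ᵥ v = b ⬝ᵥ w) (hbw : (b ⬝ᵥ w) * (b ⬝ᵥ w) = 0) (k : ℕ) :
    (velBlock v b * curvBlock R v b w c t ^ (2 * k + 1)).trace =
      -(2 * t) • ((b ⬝ᵥ w) * (-t ^ 2 • (c ⬝ᵥ w)) ^ k) := by
  have hcw : (-t ^ 2 • (c ⬝ᵥ w)) ^ k ∈ Subalgebra.center 𝕜 A :=
    pow_mem (Subalgebra.smul_mem _ (sum_mem fun j _ => mul_mem (hc j) (hw j)) _) k
  have hcomm := fun i => (Subalgebra.mem_center_iff (R := 𝕜)).1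
    (curvBlock_pow_apply_mem_center (t := t) hR hvb hw hc (2 * k + 1) (Sum.inr ()) (Sum.inl i))
    (v i)
  rw [trace_velBlock_mul, dotProduct_curvBlock_pow_odd_normal hRv hRw hbv hcv hbw]
  simp only [hcomm]
  rw [curvBlock_pow_odd_normal_dotProduct hRv hRw hbv hcv hbw,
    ← Subalgebra.mem_center_iff.1 hcw (b ⬝ᵥ w)]
  module

end BlockPowers

section ExtDMat

variable {m : ℕ} {x : Coord m} {κ κ' κ'' : Type*}

/-- The exterior derivative of a matrix of forms. -/
def extDMat (A : Coord m → Matrix κ κ' (Forms m)) (x : Coord m) : Matrix κ κ' (Forms m) :=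
  Matrix.of fun a b => extD (fun y => A y a b) x

/-- Smoothness at a point of a matrix of forms, entry by entry. -/
def MatSmoothAt (A : Coord m → Matrix κ κ' (Forms m)) (x : Coord m) : Prop :=
  ∀ a b, FormSmoothAt (fun y => A y a b) x

theorem MatSmoothAt.add {A B : Coord m → Matrix κ κ' (Forms m)} (hA : MatSmoothAt A x)
    (hB : MatSmoothAt B x) : MatSmoothAt (fun y => A y + B y) x :=
  fun a b => (hA a b).add (hB a b)

theorem MatSmoothAt.mul [Fintype κ'] {A : Coord m → Matrix κ κ' (Forms m)}
    {B : Coord m → Matrix κ' κ'' (Forms m)} (hA : MatSmoothAt A x) (hB : MatSmoothAt B x) :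
    MatSmoothAt (fun y => A y * B y) x :=
  fun a b => FormSmoothAt.sum fun j _ => (hA a j).mul (hB j b)

theorem MatSmoothAt.extDMat {A : Coord m → Matrix κ κ' (Forms m)} (hA : MatSmoothAt A x) :
    MatSmoothAt (extDMat A) x :=
  fun a b => (hA a b).extD

theorem MatSmoothAt.curvature [Fintype κ] {A : Coord m → Matrix κ κ (Forms m)}
    (hA : MatSmoothAt A x) : MatSmoothAt (curvature A) x :=
  hA.extDMat.add (hA.mul hA)

theorem extDMat_congr {A B : Coord m → Matrix κ κ' (Forms m)} (h : A =ᶠ[nhds x] B) :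
    extDMat A x = extDMat B x := by
  ext a b
  exact extD_congr (h.mono fun y hy => congrFun (congrFun hy a) b)

theorem extDMat_const (A : Matrix κ κ' (Forms m)) : extDMat (fun _ => A) x = 0 := by
  ext a b
  exact extD_const (A a b)

theorem extDMat_add {A B : Coord m → Matrix κ κ' (Forms m)} (hA : MatSmoothAt A x)
    (hB : MatSmoothAt B x) :
    extDMat (fun y => A y + B y) x = extDMat A x + extDMat B x := by
  ext a b
  exact extD_add (hA a b) (hB a b)

theorem extDMat_const_smul {A : Coord m → Matrix κ κ' (Forms m)} (hA : MatSmoothAt A x) (c : ℂ) :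
    extDMat (fun y => c • A y) x = c • extDMat A x := by
  ext a b
  exact extD_const_smul (hA a b) c

theorem extDMat_extDMat {A : Coord m → Matrix κ κ' (Forms m)} (hA : MatSmoothAt A x) :
    extDMat (extDMat A) x = 0 := by
  ext a b
  exact extD_extD (hA a b)

theorem extDMat_mul [Fintype κ'] {A : Coord m → Matrix κ κ' (Forms m)}
    {B : Coord m → Matrix κ' κ'' (Forms m)} {p : ℕ} (hA : MatSmoothAt A x) (hB : MatSmoothAt B x)
    (hp : ∀ a b, A x a b ∈ ⋀[ℂ]^p (Fin m → ℂ)) :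
    extDMat (fun y => A y * B y) x = extDMat A x * B x + (-1 : ℂ) ^ p • (A x * extDMat B x) := by
  have hsign (a : Forms m) : (-1 : ℂ) ^ p • a = (-1) ^ p * a := by
    rw [Algebra.smul_def, map_pow, map_neg, map_one]
  ext a b
  simp only [extDMat, Matrix.of_apply, Matrix.add_apply, Matrix.smul_apply, Matrix.mul_apply]
  rw [extD_sum fun j _ => (hA a j).mul (hB j b), Finset.smul_sum, ← Finset.sum_add_distrib]
  exact Finset.sum_congr rfl fun j _ => by rw [extD_mul (hA a j) (hB j b) (hp a j), hsign]

theorem extDMat_fromBlocks {l n o p : Type*} (A : Coord m → Matrix n l (Forms m))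
    (B : Coord m → Matrix n o (Forms m)) (C : Coord m → Matrix p l (Forms m))
    (D : Coord m → Matrix p o (Forms m)) :
    extDMat (fun y => Matrix.fromBlocks (A y) (B y) (C y) (D y)) x =
      Matrix.fromBlocks (extDMat A x) (extDMat B x) (extDMat C x) (extDMat D x) := by
  ext (i | i) (j | j) <;> rfl

theorem curvature_eq_extDMat_add [Fintype κ] (A : Coord m → Matrix κ κ (Forms m)) (x : Coord m) :
    curvature A x = extDMat A x + A x * A x :=
  rfl

theorem extDMat_eq_curvature_sub [Fintype κ] (A : Coord m → Matrix κ κ (Forms m)) (x : Coord m) :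
    extDMat A x = curvature A x - A x * A x :=
  (add_sub_cancel_right _ _).symm

theorem mul_apply_mem_exteriorPower [Fintype κ'] {A : Matrix κ κ' (Forms m)}
    {B : Matrix κ' κ'' (Forms m)} {p q : ℕ} (hA : ∀ a b, A a b ∈ ⋀[ℂ]^p (Fin m → ℂ))
    (hB : ∀ a b, B a b ∈ ⋀[ℂ]^q (Fin m → ℂ)) (a : κ) (b : κ'') :
    (A * B) a b ∈ ⋀[ℂ]^(p + q) (Fin m → ℂ) := by
  rw [Matrix.mul_apply]
  exact sum_mem fun j _ => SetLike.mul_mem_graded (hA a j) (hB j b)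

theorem extDMat_curvature [Fintype κ] {A : Coord m → Matrix κ κ (Forms m)} (hA : MatSmoothAt A x)
    (h1 : ∀ a b, A x a b ∈ ⋀[ℂ]^1 (Fin m → ℂ)) :
    extDMat (curvature A) x = curvature A x * A x - A x * curvature A x := by
  calc extDMat (curvature A) x
      = extDMat (extDMat A) x + extDMat (fun y => A y * A y) x :=
        extDMat_add hA.extDMat (hA.mul hA)
    _ = extDMat A x * A x - A x * extDMat A x := by
        rw [extDMat_extDMat hA, zero_add, extDMat_mul hA hA h1, pow_one, neg_one_smul,
          sub_eq_add_neg]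
    _ = curvature A x * A x - A x * curvature A x := by
        rw [extDMat_eq_curvature_sub, Matrix.sub_mul, Matrix.mul_sub, Matrix.mul_assoc]
        abel

end ExtDMat

namespace Patch

variable {m : ℕ} (P : Patch m) (x : Coord m)

/-- The vector valued `1`-form `II` as a column. -/
def colII : Matrix (Fin m) Unit (Forms m) := Matrix.replicateCol Unit (P.vecII x)

/-- The covector valued `1`-form `g(II, ·)` as a row. -/
def rowII : Matrix Unit (Fin m) (Forms m) := Matrix.replicateRow Unit (P.covecII x)

/-- The vector valued `2`-form `d^∇ II` as a column. -/
def colDII : Matrix (Fin m) Unit (Forms m) := Matrix.replicateCol Unit (P.dII x)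

/-- The components of the covariant exterior derivative of the covector valued `1`-form
`g(II, ·)`. -/
def covecDII (j : Fin m) : Forms m :=
  extD (fun y => P.covecII y j) x + ∑ l, P.covecII x l * P.leviCivita x l j

/-- The covector valued `2`-form `d^∇ g(II, ·)` as a row. -/
def rowDII : Matrix Unit (Fin m) (Forms m) := Matrix.replicateRow Unit (P.covecDII x)

theorem extDMat_colII : extDMat P.colII x = P.colDII x - P.leviCivita x * P.colII x :=
  (add_sub_cancel_right _ _).symm

theorem extDMat_rowII : extDMat P.rowII x = P.rowDII x - P.rowII x * P.leviCivita x :=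
  (add_sub_cancel_right _ _).symm

theorem vecII_mem_exteriorPower (k : Fin m) : P.vecII x k ∈ ⋀[ℂ]^1 (Fin m → ℂ) :=
  sum_smul_dx_mem_exteriorPower _

theorem covecII_mem_exteriorPower (j : Fin m) : P.covecII x j ∈ ⋀[ℂ]^1 (Fin m → ℂ) :=
  sum_smul_dx_mem_exteriorPower _

theorem leviCivita_mem_exteriorPower (k j : Fin m) : P.leviCivita x k j ∈ ⋀[ℂ]^1 (Fin m → ℂ) :=
  sum_smul_dx_mem_exteriorPower _

namespace IsRegularOn

variable {P} {W : Set (Coord m)} {x}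

theorem matSmoothAt_colII (h : P.IsRegularOn W) (hx : x ∈ W) : MatSmoothAt P.colII x :=
  fun k _ => FormSmoothAt.sum_ofReal_smul_dx fun i => h.contDiffAt_weingarten hx k i

theorem matSmoothAt_rowII (h : P.IsRegularOn W) (hx : x ∈ W) : MatSmoothAt P.rowII x :=
  fun _ j => FormSmoothAt.sum_ofReal_smul_dx fun i => h.contDiffAt_secondFF hx i j

theorem matSmoothAt_leviCivita (h : P.IsRegularOn W) (hx : x ∈ W) : MatSmoothAt P.leviCivita x :=
  fun k j => FormSmoothAt.sum_ofReal_smul_dx fun i => h.contDiffAt_christoffel_metric hx k i j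

theorem matSmoothAt_colDII (h : P.IsRegularOn W) (hx : x ∈ W) : MatSmoothAt P.colDII x :=
  (h.matSmoothAt_colII hx).extDMat.add ((h.matSmoothAt_leviCivita hx).mul (h.matSmoothAt_colII hx))

theorem matSmoothAt_rowDII (h : P.IsRegularOn W) (hx : x ∈ W) : MatSmoothAt P.rowDII x :=
  (h.matSmoothAt_rowII hx).extDMat.add ((h.matSmoothAt_rowII hx).mul (h.matSmoothAt_leviCivita hx))

theorem dII_mem_exteriorPower (h : P.IsRegularOn W) (hx : x ∈ W) (k : Fin m) :
    P.dII x k ∈ ⋀[ℂ]^2 (Fin m → ℂ) :=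
  add_mem (extD_sum_ofReal_smul_dx_mem_exteriorPower fun i => h.contDiffAt_weingarten hx k i)
    (sum_mem fun _ _ => SetLike.mul_mem_graded (P.leviCivita_mem_exteriorPower x _ _)
      (P.vecII_mem_exteriorPower x _))

theorem covecDII_mem_exteriorPower (h : P.IsRegularOn W) (hx : x ∈ W) (j : Fin m) :
    P.covecDII x j ∈ ⋀[ℂ]^2 (Fin m → ℂ) :=
  add_mem (extD_sum_ofReal_smul_dx_mem_exteriorPower fun i => h.contDiffAt_secondFF hx i j)
    (sum_mem fun _ _ => SetLike.mul_mem_graded (P.covecII_mem_exteriorPower x _)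
      (P.leviCivita_mem_exteriorPower x _ _))

theorem curvature_mem_exteriorPower (h : P.IsRegularOn W) (hx : x ∈ W) (i j : Fin m) :
    curvature P.leviCivita x i j ∈ ⋀[ℂ]^2 (Fin m → ℂ) :=
  add_mem (extD_sum_ofReal_smul_dx_mem_exteriorPower fun l =>
      h.contDiffAt_christoffel_metric hx i l j)
    (mul_apply_mem_exteriorPower (P.leviCivita_mem_exteriorPower x)
      (P.leviCivita_mem_exteriorPower x) i j)

theorem extDMat_rowDII (h : P.IsRegularOn W) (hx : x ∈ W) :
    extDMat P.rowDII x =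
      P.rowDII x * P.leviCivita x - P.rowII x * curvature P.leviCivita x := by
  have hb := h.matSmoothAt_rowII hx
  have hω := h.matSmoothAt_leviCivita hx
  calc extDMat P.rowDII x
      = extDMat (extDMat P.rowII) x + extDMat (fun y => P.rowII y * P.leviCivita y) x :=
        extDMat_add hb.extDMat (hb.mul hω)
    _ = extDMat P.rowII x * P.leviCivita x - P.rowII x * extDMat P.leviCivita x := by
        rw [extDMat_extDMat hb, zero_add,
          extDMat_mul hb hω fun _ => P.covecII_mem_exteriorPower x, pow_one, neg_one_smul,
          sub_eq_add_neg]
    _ = P.rowDII x * P.leviCivita x - P.rowII x * curvature P.leviCivita x := by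
        rw [extDMat_rowII, extDMat_eq_curvature_sub, Matrix.sub_mul, Matrix.mul_sub,
          Matrix.mul_assoc]
        abel

theorem covecII_eq_sum (h : P.IsRegularOn W) (hx : x ∈ W) (j : Fin m) :
    P.covecII x j = ∑ k, (P.metric x j k : ℂ) • P.vecII x k := by
  have hII (i : Fin m) : P.secondFF x i j = ∑ k, P.metric x j k * P.weingarten x k i :=
    (congrFun (h.metric_mulVec_weingarten hx i) j).symm
  simp only [covecII, vecII, hII, Finset.smul_sum, smul_smul, Complex.ofReal_sum,
    Complex.ofReal_mul, Finset.sum_smul]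
  exact Finset.sum_comm

theorem sum_pd_metric_smul_dx (h : P.IsRegularOn W) (hx : x ∈ W) (j k : Fin m) :
    ∑ i, (pd i (fun y => P.metric y j k) x : ℂ) • (dx i : Forms m) =
      ∑ l, (P.metric x j l : ℂ) • P.leviCivita x l k +
        ∑ l, (P.metric x k l : ℂ) • P.leviCivita x l j := by
  have hpd (i : Fin m) :=
    pd_metric_eq_sum_christoffel h.metric_isSymm (h.det_metric_ne_zero hx) i j k
  simp only [hpd, add_comm (∑ c, P.metric x k c * _), leviCivita, Matrix.of_apply,
    Finset.smul_sum, smul_smul, Complex.ofReal_add, Complex.ofReal_sum, Complex.ofReal_mul,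
    Finset.sum_smul, add_smul, Finset.sum_add_distrib]
  congr 1 <;> exact Finset.sum_comm

theorem extD_covecII (h : P.IsRegularOn W) (hx : x ∈ W) (j : Fin m) :
    extD (fun y => P.covecII y j) x = ∑ k,
      ((∑ i, (pd i (fun y => P.metric y j k) x : ℂ) • dx i) * P.vecII x k +
        (P.metric x j k : ℂ) • extD (fun y => P.vecII y k) x) := by
  have hv := fun k => h.matSmoothAt_colII hx k ()
  have hg := fun k => h.contDiffAt_metric hx j k
  calc extD (fun y => P.covecII y j) x
      = extD (fun y => ∑ k, (P.metric y j k : ℂ) • P.vecII y k) x :=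
        extD_congr ((h.isOpen.eventually_mem hx).mono fun y hy => h.covecII_eq_sum hy j)
    _ = ∑ k, extD (fun y => (P.metric y j k : ℂ) • P.vecII y k) x :=
        extD_sum fun k _ => FormSmoothAt.ofReal_smul (hg k) (hv k)
    _ = _ := Finset.sum_congr rfl fun k _ => extD_ofReal_smul (hg k) (hv k)

theorem covecDII_eq_sum (h : P.IsRegularOn W) (hx : x ∈ W) (j : Fin m) :
    P.covecDII x j = ∑ k, (P.metric x j k : ℂ) • P.dII x k := by
  have hanti : ∑ k, (∑ l, (P.metric x k l : ℂ) • P.leviCivita x l j) * P.vecII x k =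
      -∑ l, P.covecII x l * P.leviCivita x l j := by
    simp only [h.covecII_eq_sum hx, Finset.sum_mul, ← Finset.sum_neg_distrib, smul_mul_assoc]
    rw [Finset.sum_comm]
    refine Finset.sum_congr rfl fun l _ => Finset.sum_congr rfl fun k _ => ?_
    rw [mul_comm_of_mem_exteriorPower (P.leviCivita_mem_exteriorPower x l j)
      (P.vecII_mem_exteriorPower x k), (h.metric_isSymm x).apply l k]
    simp
  rw [covecDII, h.extD_covecII hx, Finset.sum_add_distrib]
  simp only [h.sum_pd_metric_smul_dx hx, add_mul, Finset.sum_add_distrib]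
  rw [hanti]
  simp only [dII, smul_add, Finset.sum_add_distrib, Finset.smul_sum, Finset.sum_mul,
    smul_mul_assoc]
  rw [Finset.sum_comm]
  abel

theorem dII_mem_center (h : P.IsRegularOn W) (hx : x ∈ W) (k : Fin m) :
    P.dII x k ∈ Subalgebra.center ℂ (Forms m) :=
  mem_center_of_mem_exteriorPower_of_even even_two (h.dII_mem_exteriorPower hx k)

theorem covecDII_mem_center (h : P.IsRegularOn W) (hx : x ∈ W) (j : Fin m) :
    P.covecDII x j ∈ Subalgebra.center ℂ (Forms m) :=
  mem_center_of_mem_exteriorPower_of_even even_two (h.covecDII_mem_exteriorPower hx j)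

theorem covecDII_dotProduct_vecII (h : P.IsRegularOn W) (hx : x ∈ W) :
    P.covecDII x ⬝ᵥ P.vecII x = P.xi x := by
  simp only [dotProduct, h.covecDII_eq_sum hx, Finset.sum_mul, smul_mul_assoc, xi]
  rw [Finset.sum_comm]
  simp only [(h.metric_isSymm x).apply]

theorem covecII_dotProduct_dII (h : P.IsRegularOn W) (hx : x ∈ W) :
    P.covecII x ⬝ᵥ P.dII x = P.xi x := by
  simp only [dotProduct, h.covecII_eq_sum hx, Finset.sum_mul, smul_mul_assoc, xi]
  refine Finset.sum_congr rfl fun k _ => Finset.sum_congr rfl fun l _ => ?_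
  rw [Subalgebra.mem_center_iff.1 (h.dII_mem_center hx k)]

theorem covecII_dotProduct_vecII (h : P.IsRegularOn W) (hx : x ∈ W) :
    P.covecII x ⬝ᵥ P.vecII x = 0 := by
  have := IsAddTorsionFree.of_isTorsionFree ℂ (Forms m)
  refine self_eq_neg.1 ?_
  simp only [dotProduct, h.covecII_eq_sum hx, Finset.sum_mul, smul_mul_assoc,
    ← Finset.sum_neg_distrib]
  conv_lhs => rw [Finset.sum_comm]
  refine Finset.sum_congr rfl fun k _ => Finset.sum_congr rfl fun l _ => ?_
  rw [(h.metric_isSymm x).apply, mul_comm_of_mem_exteriorPower (P.vecII_mem_exteriorPower x k)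
    (P.vecII_mem_exteriorPower x l)]
  simp

theorem formSmoothAt_xi (h : P.IsRegularOn W) (hx : x ∈ W) : FormSmoothAt P.xi x :=
  FormSmoothAt.sum fun k _ => FormSmoothAt.sum fun l _ =>
    FormSmoothAt.ofReal_smul (h.contDiffAt_metric hx k l)
      ((h.matSmoothAt_colDII hx k ()).mul (h.matSmoothAt_colII hx l ()))

theorem xi_mem_exteriorPower (h : P.IsRegularOn W) (hx : x ∈ W) :
    P.xi x ∈ ⋀[ℂ]^3 (Fin m → ℂ) :=
  sum_mem fun k _ => sum_mem fun l _ => Submodule.smul_mem _ _ <|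
    SetLike.mul_mem_graded (h.dII_mem_exteriorPower hx k) (P.vecII_mem_exteriorPower x l)

theorem xi_mul_xi (h : P.IsRegularOn W) (hx : x ∈ W) : P.xi x * P.xi x = 0 :=
  mul_self_eq_zero_of_mem_exteriorPower_of_odd (by decide) (h.xi_mem_exteriorPower hx)

theorem curvature_nablaT (h : P.IsRegularOn W) (hx : x ∈ W) (t : ℝ) :
    curvature (P.nablaT t) x = curvBlock (curvature P.leviCivita x) (P.vecII x) (P.covecII x)
      (P.dII x) (P.covecDII x) (t : ℂ) := by
  have hA : P.nablaT t = fun y => Matrix.fromBlocks (P.leviCivita y) ((-t : ℂ) • P.colII y)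
      ((t : ℂ) • P.rowII y) 0 := by
    ext y (i | i) (j | j) <;> simp [nablaT, nabla, wedgeN, colII, rowII, -Complex.coe_smul]
  have hbv : P.rowII x * P.colII x = 0 := by
    ext
    exact h.covecII_dotProduct_vecII hx
  rw [curvature_eq_extDMat_add, hA, extDMat_fromBlocks, Matrix.fromBlocks_multiply,
    Matrix.fromBlocks_add, extDMat_const_smul (h.matSmoothAt_colII hx),
    extDMat_const_smul (h.matSmoothAt_rowII hx), (extDMat_const 0 : extDMat 0 x = 0), extDMat_colII,
    extDMat_rowII, extDMat_eq_curvature_sub, curvBlock, Matrix.vecMulVec_eq Unit]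
  simp only [Matrix.smul_mul, Matrix.mul_smul, hbv, smul_zero, Matrix.zero_mul, Matrix.mul_zero,
    add_zero, smul_smul]
  congr 1
  · rw [← colII, ← rowII]
    module
  · rw [← colDII]
    module
  · rw [← rowDII]
    module

end IsRegularOn

/-- Permeability of a patch on a set `W`: the vector valued `3`-form `R II` vanishes on `W`. -/
def IsPermeableOn (P : Patch m) (W : Set (Coord m)) : Prop :=
  ∀ y ∈ W, ∀ k, P.curvII y k = 0

namespace IsRegularOn

variable {P} {W : Set (Coord m)} {x}

theorem curvature_mul_colII (hp : P.IsPermeableOn W) (hx : x ∈ W) :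
    curvature P.leviCivita x * P.colII x = 0 := by
  ext k _
  exact hp x hx k

theorem curvature_mul_colDII (h : P.IsRegularOn W) (hp : P.IsPermeableOn W) (hx : x ∈ W) :
    curvature P.leviCivita x * P.colDII x = 0 := by
  have hω := h.matSmoothAt_leviCivita hx
  have hd : extDMat (fun y => curvature P.leviCivita y * P.colII y) x = 0 := by
    rw [extDMat_congr ((h.isOpen.eventually_mem hx).mono fun y hy => curvature_mul_colII hp hy)]
    exact extDMat_const 0
  rw [extDMat_mul hω.curvature (h.matSmoothAt_colII hx) (h.curvature_mem_exteriorPower hx),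
    extDMat_curvature hω (P.leviCivita_mem_exteriorPower x), extDMat_colII, Matrix.sub_mul,
    Matrix.mul_sub, Matrix.mul_assoc, Matrix.mul_assoc, curvature_mul_colII hp hx,
    Matrix.mul_zero, sub_zero, neg_one_sq, one_smul, add_sub_cancel] at hd
  exact hd

theorem extD_xi (h : P.IsRegularOn W) (hp : P.IsPermeableOn W) (hx : x ∈ W) :
    extD P.xi x = P.covecDII x ⬝ᵥ P.dII x := by
  have hd : extDMat (fun y => P.rowDII y * P.colII y) x = P.rowDII x * P.colDII x := by
    rw [extDMat_mul (h.matSmoothAt_rowDII hx) (h.matSmoothAt_colII hx) fun _ =>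
      h.covecDII_mem_exteriorPower hx, h.extDMat_rowDII hx, extDMat_colII, Matrix.sub_mul,
      Matrix.mul_sub, Matrix.mul_assoc, Matrix.mul_assoc, curvature_mul_colII hp hx,
      Matrix.mul_zero, sub_zero, neg_one_sq, one_smul, add_sub_cancel]
  rw [extD_congr ((h.isOpen.eventually_mem hx).mono fun y hy =>
    (h.covecDII_dotProduct_vecII hy).symm)]
  exact congrFun (congrFun hd ()) ()

theorem extD_xi_mem_exteriorPower (h : P.IsRegularOn W) (hp : P.IsPermeableOn W) (hx : x ∈ W) :
    extD P.xi x ∈ ⋀[ℂ]^4 (Fin m → ℂ) := by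
  rw [extD_xi h hp hx]
  exact sum_mem fun l _ => SetLike.mul_mem_graded (h.covecDII_mem_exteriorPower hx l)
    (h.dII_mem_exteriorPower hx l)

theorem extD_xi_pow_mem_exteriorPower (h : P.IsRegularOn W) (hp : P.IsPermeableOn W) (hx : x ∈ W)
    (k : ℕ) : extD P.xi x ^ k ∈ ⋀[ℂ]^(k * 4) (Fin m → ℂ) :=
  SetLike.pow_mem_graded k (h.extD_xi_mem_exteriorPower hp hx)

theorem extD_extD_xi_pow (h : P.IsRegularOn W) (hp : P.IsPermeableOn W) (hx : x ∈ W) (k : ℕ) :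
    extD (fun y => extD P.xi y ^ k) x = 0 := by
  have hs := (h.formSmoothAt_xi hx).extD
  induction k with
  | zero => simpa only [pow_zero] using extD_const 1
  | succ k ih =>
    simp only [pow_succ]
    rw [extD_mul (hs.pow k) hs (h.extD_xi_pow_mem_exteriorPower hp hx k), ih,
      extD_extD (h.formSmoothAt_xi hx), zero_mul, mul_zero, mul_zero, add_zero]

theorem extD_xi_mul_extD_xi_pow (h : P.IsRegularOn W) (hp : P.IsPermeableOn W) (hx : x ∈ W)
    (k : ℕ) : extD (fun y => P.xi y * extD P.xi y ^ k) x = extD P.xi x ^ (k + 1) := by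
  have hs := h.formSmoothAt_xi hx
  rw [extD_mul hs (hs.extD.pow k) (h.xi_mem_exteriorPower hx), h.extD_extD_xi_pow hp hx,
    mul_zero, mul_zero, add_zero, pow_succ']

theorem trace_wedgeN_mul_curvature_pow (h : P.IsRegularOn W) (hp : P.IsPermeableOn W)
    (hx : x ∈ W) (t : ℝ) (k : ℕ) :
    (P.wedgeN x * curvature (P.nablaT t) x ^ (2 * k + 1)).trace =
      -(2 * (t : ℂ)) • (P.xi x * (-(t : ℂ) ^ 2 • extD P.xi x) ^ k) := by
  have hbw := h.covecII_dotProduct_dII hx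
  have hR := fun i j =>
    mem_center_of_mem_exteriorPower_of_even even_two (h.curvature_mem_exteriorPower hx i j)
  have hvb := fun i j => mem_center_of_mem_exteriorPower_of_even even_two <|
    SetLike.mul_mem_graded (P.vecII_mem_exteriorPower x i) (P.covecII_mem_exteriorPower x j)
  have hRw : (curvature P.leviCivita x).mulVec (P.dII x) = 0 :=
    funext fun i => congrFun (congrFun (h.curvature_mul_colDII hp hx) i) ()
  rw [curvature_nablaT h hx, extD_xi h hp hx, ← hbw]
  exact trace_velBlock_mul_curvBlock_pow hR hvb (h.dII_mem_center hx) (h.covecDII_mem_center hx)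
    (funext (hp x hx)) hRw (h.covecII_dotProduct_vecII hx)
    ((h.covecDII_dotProduct_vecII hx).trans hbw.symm) (hbw.symm ▸ h.xi_mul_xi hx) k

end IsRegularOn

end Patch

section PowerSeries

open PowerSeries

section Log

variable {A : Type*} [CommRing A]

theorem coeff_subst_eq_sum {f g : PowerSeries A} (hg : constantCoeff g = 0) {n N : ℕ}
    (hn : n ≤ N) :
    coeff n (f.subst g) = ∑ j ∈ Finset.range (N + 1), coeff j f * coeff n (g ^ j) := by
  rw [coeff_subst' (HasSubst.of_constantCoeff_zero' hg)]
  refine finsum_eq_sum_of_support_subset _ fun j hj => ?_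
  by_contra hjN
  have hlt : n < j := by
    simp only [Finset.coe_range, Set.mem_Iio, not_lt] at hjN
    omega
  have hdvd : (X : PowerSeries A) ^ j ∣ g ^ j := pow_dvd_pow_of_dvd (X_dvd_iff.2 hg) j
  exact hj (by simp only [X_pow_dvd_iff.1 hdvd n hlt, smul_zero])

variable [Algebra ℚ A]

theorem one_add_X_mul_derivative_log : (1 + X) * d⁄dX A (log A) = 1 := by
  rw [deriv_log]
  ext n
  cases n with
  | zero => simp
  | succ n =>
    rw [add_mul, one_mul, map_add, coeff_succ_X_mul]
    simp [pow_succ]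

theorem exp_subst_log : (exp A).subst (log A) = 1 + X := by
  have : IsAddTorsionFree A := .of_module_rat A
  set u := d⁄dX A (log A)
  set E := (exp A).subst (log A)
  have hu : (1 + X) * u = 1 := one_add_X_mul_derivative_log
  have hu' : d⁄dX A u = -u ^ 2 := by
    have h := congrArg (d⁄dX A) hu
    simp only [Derivation.leibniz, smul_eq_mul, map_add, derivative_one, derivative_X, zero_add,
      mul_one] at h
    linear_combination u * h - d⁄dX A u * hu
  have hE : d⁄dX A E = E * u := by rw [derivative_subst HasSubst.log, derivative_exp]
  have huE : u * E = 1 := by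
    refine derivative.ext ?_ ?_
    · rw [Derivation.leibniz, hE, hu', derivative_one, smul_eq_mul, smul_eq_mul]
      ring
    · have h0 : constantCoeff u = 1 := by simpa using congrArg constantCoeff hu
      have hE0 : constantCoeff E = 1 := by
        rw [← coeff_zero_eq_constantCoeff_apply, coeff_subst_eq_sum constantCoeff_log le_rfl]
        simp
      rw [map_mul, h0, hE0, map_one, one_mul]
  linear_combination (1 + X) * huE - E * hu

theorem exp_subst_logOf {F : PowerSeries A} (hF : constantCoeff F = 1) :
    (exp A).subst (logOf F) = F := by
  have hs : HasSubst (F - 1) := HasSubst.of_constantCoeff_zero' (by simp [hF])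
  rw [logOf_eq, ← subst_comp_subst_apply HasSubst.log hs, exp_subst_log, subst_add hs, subst_X hs,
    ← coe_substAlgHom hs, map_one, add_sub_cancel]

theorem logOf_expand {p : ℕ} (hp : p ≠ 0) {F : PowerSeries A} (hF : constantCoeff F = 1) :
    logOf (expand p hp F) = expand p hp (logOf F) := by
  have hs : HasSubst (F - 1) := HasSubst.of_constantCoeff_zero' (by simp [hF])
  have hsub : expand p hp F - 1 = expand p hp (F - 1) := by rw [map_sub, map_one]
  rw [logOf_eq, hsub]
  exact (expand_subst p hp hs _).symm

end Log

/-- The power series `∑ₖ F₂ₖ zᵏ`, that is `F(√z)` for an even power series `F`. -/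
def evenPart {A : Type*} [Semiring A] (F : PowerSeries A) : PowerSeries A :=
  mk fun n => coeff (2 * n) F

theorem expand_evenPart {A : Type*} [CommRing A] {F : PowerSeries A}
    (hF : ∀ n, Odd n → coeff n F = 0) : expand 2 two_ne_zero (evenPart F) = F := by
  ext n
  rcases Nat.even_or_odd' n with ⟨k, rfl | rfl⟩
  · rw [coeff_expand_mul, evenPart, coeff_mk]
  · rw [coeff_expand_of_not_dvd 2 two_ne_zero _ (by omega), hF _ (odd_two_mul_add_one k)]

theorem constantCoeff_evenPart {A : Type*} [Semiring A] (F : PowerSeries A) :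
    constantCoeff (evenPart F) = constantCoeff F := by
  rw [← coeff_zero_eq_constantCoeff_apply, ← coeff_zero_eq_constantCoeff_apply, evenPart, coeff_mk]

theorem evenPart_logOf {A : Type*} [CommRing A] [Algebra ℚ A] {F : PowerSeries A}
    (hF : constantCoeff F = 1) (heven : ∀ n, Odd n → coeff n F = 0) :
    evenPart (logOf F) = logOf (evenPart F) := by
  ext n
  rw [evenPart, coeff_mk, ← expand_evenPart heven,
    logOf_expand two_ne_zero ((constantCoeff_evenPart F).trans hF), coeff_expand_mul,
    expand_evenPart heven]

section Nilpotent

variable {R A : Type*} [CommRing R] [Ring A] [Algebra R A] {s : A} {m : ℕ}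

theorem aeval_trunc (p : PowerSeries R) :
    Polynomial.aeval s (trunc (m + 1) p) = ∑ k ∈ Finset.range (m + 1), coeff k p • s ^ k := by
  rw [Polynomial.aeval_eq_sum_range' (natDegree_trunc_lt p m)]
  refine Finset.sum_congr rfl fun k hk => ?_
  rw [coeff_trunc, if_pos (Finset.mem_range.1 hk)]

theorem aeval_trunc_coe (hs : s ^ (m + 1) = 0) (q : Polynomial R) :
    Polynomial.aeval s (trunc (m + 1) (q : PowerSeries R)) = Polynomial.aeval s q := by
  obtain ⟨r, hr⟩ : Polynomial.X ^ (m + 1) ∣ q - trunc (m + 1) (q : PowerSeries R) := by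
    refine Polynomial.X_pow_dvd_iff.2 fun d hd => ?_
    rw [Polynomial.coeff_sub, coeff_trunc, if_pos hd, Polynomial.coeff_coe, sub_self]
  have h := congrArg (Polynomial.aeval s) hr
  rw [map_sub, map_mul, map_pow, Polynomial.aeval_X, hs, zero_mul, sub_eq_zero] at h
  exact h.symm

theorem aeval_trunc_pow (hs : s ^ (m + 1) = 0) (p : PowerSeries R) (j : ℕ) :
    Polynomial.aeval s (trunc (m + 1) (p ^ j)) = Polynomial.aeval s (trunc (m + 1) p) ^ j := by
  rw [← trunc_trunc_pow, ← Polynomial.coe_pow, aeval_trunc_coe hs, map_pow]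

theorem aeval_trunc_subst (hs : s ^ (m + 1) = 0) (f : PowerSeries R) {g : PowerSeries R}
    (hg : constantCoeff g = 0) :
    Polynomial.aeval s (trunc (m + 1) (f.subst g)) =
      ∑ j ∈ Finset.range (m + 1), coeff j f • Polynomial.aeval s (trunc (m + 1) g) ^ j := by
  simp only [← aeval_trunc_pow hs]
  simp only [aeval_trunc, Finset.smul_sum, smul_smul]
  rw [Finset.sum_comm]
  refine Finset.sum_congr rfl fun k hk => ?_
  rw [coeff_subst_eq_sum hg (Finset.mem_range_succ_iff.1 hk), Finset.sum_smul]

end Nilpotent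

variable {m : ℕ} {η : Forms m}

theorem evalSqrt_eq_aeval_trunc (F : PowerSeries ℂ) (η : Forms m) :
    evalSqrt F η = Polynomial.aeval η (trunc (m + 1) (evenPart F)) := by
  simp only [evalSqrt, aeval_trunc, evenPart, coeff_mk]

theorem evalSeries_exp_evalSqrt_logOf {F : PowerSeries ℂ} (hF : IsEvenUnitSeries F)
    (hη : η ^ (m + 1) = 0) :
    evalSeries (exp ℂ) (evalSqrt (logOf F) η) = evalSqrt F η := by
  rw [evalSqrt_eq_aeval_trunc F, ← exp_subst_logOf ((constantCoeff_evenPart F).trans hF.1),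
    ← evenPart_logOf hF.1 hF.2, aeval_trunc_subst hη _
      ((constantCoeff_evenPart _).trans (constantCoeff_logOf hF.1)),
    ← evalSqrt_eq_aeval_trunc, evalSeries]

end PowerSeries

section TimeCalculus

variable {m : ℕ}

theorem HasTimeDerivAt.timeDeriv_eq {c : ℝ → Forms m} {c' : Forms m} {t : ℝ}
    (h : HasTimeDerivAt c c' t) : timeDeriv c t = c' := by
  rw [timeDeriv, ← sum_formCoeff_smul_formBasis c']
  exact Finset.sum_congr rfl fun s _ => by rw [(h s).deriv]

theorem hasTimeDerivAt_sum_smul {α : Type*} {S : Finset α} {q : α → ℝ → ℂ} {q' : α → ℂ}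
    {t : ℝ} (b : α → Forms m) (h : ∀ k ∈ S, HasDerivAt (q k) (q' k) t) :
    HasTimeDerivAt (fun τ => ∑ k ∈ S, q k τ • b k) (∑ k ∈ S, q' k • b k) t := fun s => by
  simp only [map_sum, map_smul, smul_eq_mul]
  exact HasDerivAt.fun_sum fun k hk => (h k hk).mul_const _

theorem timeIntegral_eq_sub {C c : ℝ → Forms m} (h : ∀ t, HasTimeDerivAt C (c t) t)
    (hc : ∀ s, Continuous fun t => formCoeff s (c t)) (a b : ℝ) :
    timeIntegral c a b = C b - C a := by
  rw [← sum_formCoeff_smul_formBasis (C b - C a), timeIntegral]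
  refine Finset.sum_congr rfl fun s _ => ?_
  rw [intervalIntegral.integral_eq_sub_of_hasDerivAt (fun t _ => h t s)
    ((hc s).intervalIntegrable a b), map_sub]

end TimeCalculus

section InterpolationFactor

/-- The factor `t² / 4π²` by which the forms `ξ` and `dξ` are rescaled at time `t`. -/
abbrev scale (t : ℝ) : ℂ := (t : ℂ) ^ 2 / (4 * (Real.pi : ℂ) ^ 2)

theorem hasDerivAt_scale_pow (k : ℕ) (t : ℝ) :
    HasDerivAt (fun τ => scale τ ^ (k + 1))
      ((k + 1) * scale t ^ k * (2 * t / (4 * (Real.pi : ℂ) ^ 2))) t := by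
  simpa using
    (((hasDerivAt_pow 2 (t : ℂ)).div_const (4 * (Real.pi : ℂ) ^ 2)).fun_pow (k + 1)).comp_ofReal

end InterpolationFactor

namespace Patch

variable {m : ℕ} {P : Patch m} {W : Set (Coord m)} {x : Coord m}

theorem connVelocity_nablaT (P : Patch m) (t : ℝ) : connVelocity P.nablaT t = P.wedgeN := by
  ext x : 1
  ext a b
  refine HasTimeDerivAt.timeDeriv_eq (c := fun τ => P.nablaT τ x a b) fun s => ?_
  simpa [-Complex.coe_smul, nablaT] using
    ((hasDerivAt_id (t : ℂ)).comp_ofReal.mul_const (formCoeff s (P.wedgeN x a b))).const_add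
      (formCoeff s (P.nabla x a b))

namespace IsRegularOn

theorem logTransgression_nablaT (h : P.IsRegularOn W) (hp : P.IsPermeableOn W)
    (F : PowerSeries ℂ) (hx : x ∈ W) (t : ℝ) :
    logTransgression F (P.nablaT t) P.wedgeN x = ∑ k ∈ Finset.range m,
      (PowerSeries.coeff (2 * (k + 1)) (PowerSeries.logOf F) *
        ((k + 1) * scale t ^ k * (2 * t / (4 * (Real.pi : ℂ) ^ 2)))) •
          (P.xi x * extD P.xi x ^ k) := by
  have hI : ((2 * (Real.pi : ℂ) * Complex.I)⁻¹) ^ 2 = -(4 * (Real.pi : ℂ) ^ 2)⁻¹ := by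
    rw [inv_pow, mul_pow, mul_pow, Complex.I_sq, ← inv_neg]
    ring_nf
  rw [logTransgression, ← Finset.Ico_add_one_right_eq_Icc, Finset.sum_Ico_eq_sum_range]
  refine Finset.sum_congr (by simp) fun k _ => ?_
  rw [show 2 * (1 + k) - 1 = 2 * k + 1 by omega, smul_pow, smul_mul_smul_comm, Matrix.trace_smul,
    trace_wedgeN_mul_curvature_pow h hp hx, ← pow_succ', smul_pow, mul_smul_comm, smul_smul,
    smul_smul, smul_smul, show 2 * k + 1 + 1 = 2 * (k + 1) by ring, pow_mul, hI, add_comm 1 k]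
  congr 1
  have hsq : ((-1 : ℂ) ^ k) * (-1) ^ k = 1 := by rw [← mul_pow]; simp
  rw [neg_pow (4 * (Real.pi : ℂ) ^ 2)⁻¹, neg_pow ((t : ℂ) ^ 2), div_pow, inv_pow,
    pow_succ (-1 : ℂ) k]
  push_cast
  linear_combination ((PowerSeries.coeff (2 * (k + 1)) (PowerSeries.logOf F)) /
    (4 * (Real.pi : ℂ) ^ 2) ^ (k + 1) * (2 * k + 2) * (t : ℂ) ^ (2 * k + 1)) * hsq

theorem xi_mul_extD_xi_pow_eq_zero (h : P.IsRegularOn W) (hp : P.IsPermeableOn W)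
    (hx : x ∈ W) : P.xi x * extD P.xi x ^ m = 0 :=
  eq_zero_of_mem_exteriorPower_of_finrank_lt (n := 3 + m * 4) (by simp; omega)
    (SetLike.GradedMul.mul_mem (h.xi_mem_exteriorPower hx)
      (h.extD_xi_pow_mem_exteriorPower hp hx m))

theorem extD_xi_pow_eq_zero (h : P.IsRegularOn W) (hp : P.IsPermeableOn W) (hx : x ∈ W) :
    extD P.xi x ^ (m + 1) = 0 :=
  eq_zero_of_mem_exteriorPower_of_finrank_lt (n := (m + 1) * 4) (by simp; omega)
    (h.extD_xi_pow_mem_exteriorPower hp hx (m + 1))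

theorem xi_mul_evalSqrt_LF (h : P.IsRegularOn W) (hp : P.IsPermeableOn W)
    (F : PowerSeries ℂ) (hx : x ∈ W) (t : ℝ) :
    (scale t • P.xi x) * evalSqrt (LF F) (scale t • extD P.xi x) = ∑ k ∈ Finset.range m,
      (PowerSeries.coeff (2 * (k + 1)) (PowerSeries.logOf F) * scale t ^ (k + 1)) •
        (P.xi x * extD P.xi x ^ k) := by
  rw [evalSqrt, Finset.mul_sum, Finset.sum_range_succ]
  simp only [smul_pow, mul_smul_comm, smul_mul_assoc, xi_mul_extD_xi_pow_eq_zero h hp hx,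
    smul_zero, add_zero, smul_smul, LF, PowerSeries.coeff_mk, mul_add_one, pow_succ, mul_assoc]

theorem hasTimeDerivAt_xi_mul_evalSqrt_LF (h : P.IsRegularOn W) (hp : P.IsPermeableOn W)
    (F : PowerSeries ℂ) (hx : x ∈ W) (t : ℝ) :
    HasTimeDerivAt
      (fun τ => (scale τ • P.xi x) * evalSqrt (LF F) (scale τ • extD P.xi x))
      (logTransgression F (P.nablaT t) P.wedgeN x) t := by
  rw [h.logTransgression_nablaT hp F hx]
  simp only [h.xi_mul_evalSqrt_LF hp F hx]
  exact hasTimeDerivAt_sum_smul _ fun k _ => (hasDerivAt_scale_pow k t).const_mul _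

theorem extD_logTransgression_nablaT (h : P.IsRegularOn W) (hp : P.IsPermeableOn W)
    (F : PowerSeries ℂ) (hx : x ∈ W) (t : ℝ) :
    extD (logTransgression F (P.nablaT t) P.wedgeN) x = ∑ k ∈ Finset.range m,
      (PowerSeries.coeff (2 * (k + 1)) (PowerSeries.logOf F) *
        ((k + 1) * scale t ^ k * (2 * t / (4 * (Real.pi : ℂ) ^ 2)))) •
          extD P.xi x ^ (k + 1) := by
  have hs (k : ℕ) : FormSmoothAt (fun y => P.xi y * extD P.xi y ^ k) x :=
    (h.formSmoothAt_xi hx).mul ((h.formSmoothAt_xi hx).extD.pow k)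
  rw [extD_congr ((h.isOpen.eventually_mem hx).mono
      fun y hy => h.logTransgression_nablaT hp F hy t),
    extD_sum fun k _ => (hs k).const_smul _]
  refine Finset.sum_congr rfl fun k _ => ?_
  rw [extD_const_smul (hs k), extD_xi_mul_extD_xi_pow h hp hx]

theorem timeIntegral_extD_logTransgression_nablaT (h : P.IsRegularOn W) (hp : P.IsPermeableOn W)
    {F : PowerSeries ℂ} (hF : PowerSeries.constantCoeff F = 1) (hx : x ∈ W) (t : ℝ) :
    timeIntegral (fun τ => extD (logTransgression F (P.nablaT τ) P.wedgeN) x) 0 t =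
      evalSqrt (PowerSeries.logOf F) (scale t • extD P.xi x) := by
  simp only [h.extD_logTransgression_nablaT hp F hx]
  rw [timeIntegral_eq_sub fun τ => hasTimeDerivAt_sum_smul _
    fun k _ => (hasDerivAt_scale_pow k τ).const_mul _]
  · rw [evalSqrt, Finset.sum_range_succ', mul_zero,
      PowerSeries.coeff_zero_eq_constantCoeff_apply, PowerSeries.constantCoeff_logOf hF]
    simp [smul_pow, smul_smul, scale]
  · intro s
    simp only [map_sum, map_smul, smul_eq_mul]
    fun_prop

theorem transgression_nablaT (h : P.IsRegularOn W) (hp : P.IsPermeableOn W) {F : PowerSeries ℂ}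
    (hF : IsEvenUnitSeries F) (hx : x ∈ W) :
    transgression F P.nablaT x = timeIntegral (fun t =>
      evalSqrt F (scale t • extD P.xi x) * logTransgression F (P.nablaT t) P.wedgeN x) 0 1 := by
  rw [transgression]
  congr 1
  ext t
  simp only [connVelocity_nablaT]
  rw [h.timeIntegral_extD_logTransgression_nablaT hp hF.1 hx, evalSeries_exp_evalSqrt_logOf hF]
  rw [smul_pow, h.extD_xi_pow_eq_zero hp hx, smul_zero]

end IsRegularOn

end Patch

section Charts

variable {n : ℕ} {M : Type*} [TopologicalSpace M] [ChartedSpace (EuclideanSpace ℝ (Fin n)) M]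

theorem mdifferentiable_of_mem_maximalAtlas
    {ψ : OpenPartialHomeomorph M (EuclideanSpace ℝ (Fin n))}
    (hψ : ψ ∈ IsManifold.maximalAtlas (𝓡 n) ∞ M) : ψ.MDifferentiable (𝓡 n) (𝓡 n) :=
  ⟨(contMDiffOn_of_mem_maximalAtlas hψ).mdifferentiableOn (by simp),
    (contMDiffOn_symm_of_mem_maximalAtlas hψ).mdifferentiableOn (by simp)⟩

end Charts

theorem contMDiffOn_tangentMap_of_isOpen {E H E' H' : Type*} [NormedAddCommGroup E]
    [NormedSpace ℝ E] [TopologicalSpace H] {I : ModelWithCorners ℝ E H} [NormedAddCommGroup E']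
    [NormedSpace ℝ E'] [TopologicalSpace H'] {I' : ModelWithCorners ℝ E' H'}
    {M M' : Type*} [TopologicalSpace M] [ChartedSpace H M] [IsManifold I ∞ M]
    [TopologicalSpace M'] [ChartedSpace H' M'] [IsManifold I' ∞ M'] {f : M → M'} {s : Set M}
    (hs : IsOpen s) (hf : ContMDiffOn I I' ∞ f s) :
    ContMDiffOn I.tangent I'.tangent ∞ (tangentMap I I' f)
      (Bundle.TotalSpace.proj (F := E) (E := TangentSpace I (M := M)) ⁻¹' s) := by
  refine (hf.contMDiffOn_tangentMapWithin (by simp) hs.uniqueMDiffOn).congr fun p hp => ?_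
  rw [tangentMap, tangentMapWithin, mfderivWithin_of_isOpen hs hp]

theorem bilin_apply_eq_sum_single {n : ℕ} {T : Type*} [AddCommGroup T] [Module ℝ T]
    [TopologicalSpace T] (B : T →L[ℝ] T →L[ℝ] ℝ) (L : EuclideanSpace ℝ (Fin n) →L[ℝ] T)
    (u w : EuclideanSpace ℝ (Fin n)) :
    B (L u) (L w) =
      ∑ a, ∑ b, B (L (EuclideanSpace.single a 1)) (L (EuclideanSpace.single b 1)) * u a * w b := by
  conv_lhs =>
    rw [← (EuclideanSpace.basisFun (Fin n) ℝ).sum_repr u,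
      ← (EuclideanSpace.basisFun (Fin n) ℝ).sum_repr w]
  simp only [EuclideanSpace.basisFun_apply, EuclideanSpace.basisFun_repr, map_sum, map_smul,
    sum_apply, smul_apply, smul_eq_mul, Finset.mul_sum]
  rw [Finset.sum_comm]
  exact Finset.sum_congr rfl fun a _ => Finset.sum_congr rfl fun b _ => by ring

theorem Patch.linearIndependent_tangent {m : ℕ} {P : Patch m} {x : Coord m}
    (hf : DifferentiableAt ℝ P.f x) (hinj : Function.Injective (fderiv ℝ P.f x)) :
    LinearIndependent ℝ fun i => P.tangent i x := by
  have h := ((EuclideanSpace.basisFun (Fin m) ℝ).toBasis.linearIndependent.map'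
    (fderiv ℝ P.f x : Coord m →ₗ[ℝ] Coord (m + 1)) (LinearMap.ker_eq_bot.2 hinj)).map'
    (WithLp.linearEquiv 2 ℝ (Fin (m + 1) → ℝ)).toLinearMap (LinearEquiv.ker _)
  have htangent : (fun i => P.tangent i x) =
      fun i => (fderiv ℝ P.f x (EuclideanSpace.single i 1)).ofLp := by
    ext i c
    exact (fderiv_apply_single_apply hf i c).symm
  rw [htangent]
  simpa [Function.comp_def] using h

section Immersion

variable {m : ℕ} {M : Type*} [TopologicalSpace M]
  {M' : Type*} [TopologicalSpace M'] [ChartedSpace (EuclideanSpace ℝ (Fin (m + 1))) M']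
  {ι : M → M'} {U : Set M} {φ : OpenPartialHomeomorph M (EuclideanSpace ℝ (Fin m))}
  {ψ : OpenPartialHomeomorph M' (EuclideanSpace ℝ (Fin (m + 1)))}
  {x : EuclideanSpace ℝ (Fin m)}

theorem isOpen_patchDomain [ChartedSpace (EuclideanSpace ℝ (Fin m)) M]
    (hι : IsHypersurface (m := m) ι) (hU : IsOpen U) :
    IsOpen (patchDomain ι U φ ψ) :=
  φ.symm.isOpen_inter_preimage (hU.inter (ψ.open_source.preimage hι.1.continuous))

variable [IsManifold (𝓡 (m + 1)) ∞ M']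
  (g : Bundle.ContMDiffRiemannianMetric (𝓡 (m + 1)) ∞ (EuclideanSpace ℝ (Fin (m + 1)))
      (fun q : M' => TangentSpace (𝓡 (m + 1)) q))
  {N : ∀ p : M, TangentSpace (𝓡 (m + 1)) (ι p)}

theorem inner_congr_point {q q' : M'} (h : q' = q) (v w : EuclideanSpace ℝ (Fin (m + 1))) :
    g.inner q' (show TangentSpace (𝓡 (m + 1)) q' from v) (show TangentSpace (𝓡 (m + 1)) q' from w)
    = g.inner q (show TangentSpace (𝓡 (m + 1)) q from v)
      (show TangentSpace (𝓡 (m + 1)) q from w) := by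
  subst h; rfl

theorem ip_patch (hψ : ψ ∈ IsManifold.maximalAtlas (𝓡 (m + 1)) ∞ M')
    (hx : x ∈ patchDomain ι U φ ψ) (v w : TangentSpace (𝓡 (m + 1)) (ι (φ.symm x))) :
    (patch g ι N φ ψ).ip x
        (show EuclideanSpace ℝ (Fin (m + 1)) from
          mfderiv (𝓡 (m + 1)) (𝓡 (m + 1)) ψ (ι (φ.symm x)) v).ofLp
        (show EuclideanSpace ℝ (Fin (m + 1)) from
          mfderiv (𝓡 (m + 1)) (𝓡 (m + 1)) ψ (ι (φ.symm x)) w).ofLp =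
      g.inner (ι (φ.symm x)) v w := by
  have hinv (u : EuclideanSpace ℝ (Fin (m + 1))) :
      (show EuclideanSpace ℝ (Fin (m + 1)) from mfderiv (𝓡 (m + 1)) (𝓡 (m + 1)) ψ.symm
        (ψ (ι (φ.symm x))) (mfderiv (𝓡 (m + 1)) (𝓡 (m + 1)) ψ (ι (φ.symm x)) u)) = u :=
    congrArg (fun L : EuclideanSpace ℝ (Fin (m + 1)) →L[ℝ] EuclideanSpace ℝ (Fin (m + 1)) => L u)
      ((mdifferentiable_of_mem_maximalAtlas hψ).symm_comp_deriv hx.2.2)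
  rw [Patch.ip_eq_sum]
  refine (bilin_apply_eq_sum_single
    (T := TangentSpace (𝓡 (m + 1)) (ψ.symm (ψ (ι (φ.symm x))))) (g.inner _)
    (mfderiv (𝓡 (m + 1)) (𝓡 (m + 1)) ψ.symm (ψ (ι (φ.symm x)))) _ _).symm.trans ?_
  refine Eq.trans ?_ (inner_congr_point g (ψ.left_inv hx.2.2) v w)
  exact congrArg₂ (fun v w : EuclideanSpace ℝ (Fin (m + 1)) =>
    g.inner (ψ.symm (ψ (ι (φ.symm x)))) v w) (hinv v) (hinv w)

theorem contDiffAt_patch_G (hψ : ψ ∈ IsManifold.maximalAtlas (𝓡 (m + 1)) ∞ M')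
    {y : EuclideanSpace ℝ (Fin (m + 1))} (hy : y ∈ ψ.target) (a b : Fin (m + 1)) :
    ContDiffAt ℝ ∞ (fun z => (patch g ι N φ ψ).G z a b) y := by
  have hψsymm := contMDiffOn_symm_of_mem_maximalAtlas hψ
  have hcoord (c : Fin (m + 1)) : ContMDiffOn (𝓡 (m + 1)) (𝓡 (m + 1)).tangent ∞
      (fun z : EuclideanSpace ℝ (Fin (m + 1)) => (⟨ψ.symm z,
        mfderiv (𝓡 (m + 1)) (𝓡 (m + 1)) ψ.symm z (EuclideanSpace.single c (1 : ℝ))⟩ :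
          TangentBundle (𝓡 (m + 1)) M')) ψ.target :=
    (contMDiffOn_tangentMap_of_isOpen ψ.open_target hψsymm).comp
      (f := fun z => ⟨z, EuclideanSpace.single c (1 : ℝ)⟩)
      (fun _ _ => contMDiffWithinAt_vectorSpace_iff_contDiffWithinAt.2 contDiffWithinAt_const)
      fun _ hz => hz
  have h := ContMDiffWithinAt.clm_bundle_apply₂ (F₁ := EuclideanSpace ℝ (Fin (m + 1)))
    (F₂ := EuclideanSpace ℝ (Fin (m + 1))) (F₃ := ℝ) (E₃ := Bundle.Trivial M' ℝ)
    (ψ := fun z => g.inner (ψ.symm z))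
    (g.contMDiff.contMDiffAt.comp_contMDiffWithinAt y (hψsymm y hy))
    (hcoord a y hy) (hcoord b y hy)
  simp only [Bundle.contMDiffWithinAt_totalSpace] at h
  exact (contMDiffWithinAt_iff_contDiffWithinAt.1 h.2).contDiffAt (ψ.open_target.mem_nhds hy)

theorem posDef_patch_G (hψ : ψ ∈ IsManifold.maximalAtlas (𝓡 (m + 1)) ∞ M')
    (hx : x ∈ patchDomain ι U φ ψ) :
    ((patch g ι N φ ψ).G ((patch g ι N φ ψ).f x)).PosDef := by
  refine Matrix.PosDef.of_dotProduct_mulVec_pos ?_ fun u hu => ?_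
  · ext a b
    exact g.symm _ _ _
  · obtain ⟨v, hv⟩ :=
      (mdifferentiable_of_mem_maximalAtlas hψ).mfderiv_surjective hx.2.2 (WithLp.toLp 2 u)
    have hv0 : v ≠ 0 := fun h0 => hu <| by
      rw [h0, map_zero] at hv
      exact congrArg WithLp.ofLp hv.symm
    have hip := ip_patch (N := N) g hψ hx v v
    rw [hv] at hip
    exact lt_of_lt_of_eq (g.pos _ v hv0) (hip.symm.trans (Patch.ip_eq_dotProduct _ _ _ _))

variable [ChartedSpace (EuclideanSpace ℝ (Fin m)) M]

theorem contDiffAt_patch_f (hι : IsHypersurface (m := m) ι)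
    (hφ : φ ∈ IsManifold.maximalAtlas (𝓡 m) ∞ M)
    (hψ : ψ ∈ IsManifold.maximalAtlas (𝓡 (m + 1)) ∞ M') (hx : x ∈ patchDomain ι U φ ψ) :
    ContDiffAt ℝ ∞ (patch g ι N φ ψ).f x := by
  have h : ContMDiffAt (𝓡 m) (𝓡 (m + 1)) ∞ (ψ ∘ (ι ∘ φ.symm)) x :=
    (contMDiffAt_of_mem_maximalAtlas hψ hx.2.2).comp x
      ((hι.1 _).comp x (contMDiffAt_symm_of_mem_maximalAtlas hφ hx.1))
  exact contMDiffAt_iff_contDiffAt.1 h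

theorem fderiv_patch_f (hι : IsHypersurface (m := m) ι)
    (hφ : φ ∈ IsManifold.maximalAtlas (𝓡 m) ∞ M)
    (hψ : ψ ∈ IsManifold.maximalAtlas (𝓡 (m + 1)) ∞ M') (hx : x ∈ patchDomain ι U φ ψ) :
    fderiv ℝ (patch g ι N φ ψ).f x =
      (mfderiv (𝓡 (m + 1)) (𝓡 (m + 1)) ψ (ι (φ.symm x))).comp
        ((mfderiv (𝓡 m) (𝓡 (m + 1)) ι (φ.symm x)).comp (mfderiv (𝓡 m) (𝓡 m) φ.symm x)) := by
  have hφx := (mdifferentiable_of_mem_maximalAtlas hφ).mdifferentiableAt_symm hx.1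
  have hιx : MDifferentiableAt (𝓡 m) (𝓡 (m + 1)) ι (φ.symm x) :=
    (hι.1 _).mdifferentiableAt (by simp)
  have hψx := (mdifferentiable_of_mem_maximalAtlas hψ).mdifferentiableAt hx.2.2
  rw [← mfderiv_comp x hιx hφx]
  exact mfderiv_eq_fderiv.symm.trans (mfderiv_comp x hψx (hιx.comp x hφx))

theorem patch_tangent (hι : IsHypersurface (m := m) ι)
    (hφ : φ ∈ IsManifold.maximalAtlas (𝓡 m) ∞ M)
    (hψ : ψ ∈ IsManifold.maximalAtlas (𝓡 (m + 1)) ∞ M') (hx : x ∈ patchDomain ι U φ ψ)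
    (i : Fin m) :
    (patch g ι N φ ψ).tangent i x =
      (show EuclideanSpace ℝ (Fin (m + 1)) from
        mfderiv (𝓡 (m + 1)) (𝓡 (m + 1)) ψ (ι (φ.symm x)) (mfderiv (𝓡 m) (𝓡 (m + 1)) ι (φ.symm x)
          (mfderiv (𝓡 m) (𝓡 m) φ.symm x (EuclideanSpace.single i (1 : ℝ))))).ofLp := by
  ext c
  refine (fderiv_apply_single_apply
    ((contDiffAt_patch_f g hι hφ hψ hx).differentiableAt (by simp)) i c).symm.trans ?_
  rw [fderiv_patch_f g hι hφ hψ hx]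
  rfl

theorem linearIndependent_patch_tangent (hι : IsHypersurface (m := m) ι)
    (hφ : φ ∈ IsManifold.maximalAtlas (𝓡 m) ∞ M)
    (hψ : ψ ∈ IsManifold.maximalAtlas (𝓡 (m + 1)) ∞ M') (hx : x ∈ patchDomain ι U φ ψ) :
    LinearIndependent ℝ fun i => (patch g ι N φ ψ).tangent i x := by
  refine Patch.linearIndependent_tangent
    ((contDiffAt_patch_f g hι hφ hψ hx).differentiableAt (by simp)) ?_
  rw [fderiv_patch_f g hι hφ hψ hx]
  exact ((mdifferentiable_of_mem_maximalAtlas hψ).mfderiv_injective hx.2.2).comp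
    ((hι.2 _).comp ((mdifferentiable_of_mem_maximalAtlas hφ).symm.mfderiv_injective hx.1))

theorem contDiffOn_patch_N (hN : IsUnitNormal g ι U N)
    (hφ : φ ∈ IsManifold.maximalAtlas (𝓡 m) ∞ M)
    (hψ : ψ ∈ IsManifold.maximalAtlas (𝓡 (m + 1)) ∞ M') (c : Fin (m + 1)) :
    ContDiffOn ℝ ∞ (fun y => (patch g ι N φ ψ).N y c) (patchDomain ι U φ ψ) := by
  have hNφ : ContMDiffOn (𝓡 m) (𝓡 (m + 1)).tangent ∞
      (fun x => (⟨ι (φ.symm x), N (φ.symm x)⟩ : TangentBundle (𝓡 (m + 1)) M'))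
      (patchDomain ι U φ ψ) :=
    hN.1.comp ((contMDiffOn_symm_of_mem_maximalAtlas hφ).mono fun x hx => hx.1)
      fun x hx => hx.2.1
  have hψN := (contMDiffOn_tangentMap_of_isOpen ψ.open_source
    (contMDiffOn_of_mem_maximalAtlas hψ)).comp hNφ fun x hx => hx.2.2
  have hsnd := (contMDiff_snd_tangentBundle_modelSpace (𝕜 := ℝ) (EuclideanSpace ℝ (Fin (m + 1)))
    (𝓡 (m + 1)) (n := ∞)).comp_contMDiffOn hψN
  exact (EuclideanSpace.proj (𝕜 := ℝ) c).contDiff.comp_contDiffOn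
    (contMDiffOn_iff_contDiffOn.1 hsnd)

theorem patch_isRegularOn (hι : IsHypersurface (m := m) ι) (hU : IsOpen U)
    (hN : IsUnitNormal g ι U N) (hφ : φ ∈ IsManifold.maximalAtlas (𝓡 m) ∞ M)
    (hψ : ψ ∈ IsManifold.maximalAtlas (𝓡 (m + 1)) ∞ M') :
    (patch g ι N φ ψ).IsRegularOn (patchDomain ι U φ ψ) where
  isOpen := isOpen_patchDomain hι hU
  smooth_G _ hx := contDiffAt_patch_G g hψ (ψ.map_source hx.2.2)
  smooth_f _ hx := contDiffAt_patch_f g hι hφ hψ hx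
  smooth_N _ hx c :=
    (contDiffOn_patch_N g hN hφ hψ c).contDiffAt ((isOpen_patchDomain hι hU).mem_nhds hx)
  symm _ := Matrix.ext fun _ _ => g.symm _ _ _
  posDef _ hx := posDef_patch_G g hψ hx
  unit _ hx := (ip_patch g hψ hx _ _).trans (hN.2 _ hx.2.1).1
  orth _ hx i := by
    rw [patch_tangent g hι hφ hψ hx]
    exact (ip_patch g hψ hx _ _).trans ((hN.2 _ hx.2.1).2 _)
  indep _ hx := linearIndependent_patch_tangent g hι hφ hψ hx

end Immersion

end PermeableHypersurface

end

theorem mainTheorem4 {m : ℕ}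
    {M : Type*} [TopologicalSpace M] [ChartedSpace (EuclideanSpace ℝ (Fin m)) M]
    [IsManifold (𝓡 m) ∞ M]
    {M' : Type*} [TopologicalSpace M'] [ChartedSpace (EuclideanSpace ℝ (Fin (m + 1))) M']
    [IsManifold (𝓡 (m + 1)) ∞ M']
    (g : Bundle.ContMDiffRiemannianMetric (𝓡 (m + 1)) ∞ (EuclideanSpace ℝ (Fin (m + 1)))
      (fun q : M' => TangentSpace (𝓡 (m + 1)) q))
    (ι : M → M') (hι : PermeableHypersurface.IsHypersurface (m := m) ι)
    (hperm : PermeableHypersurface.IsPermeable (m := m) g ι)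
    (F : PowerSeries ℂ) (hF : PermeableHypersurface.IsEvenUnitSeries F)
    (U : Set M) (hU : IsOpen U) (N : ∀ p : M, TangentSpace (𝓡 (m + 1)) (ι p))
    (hN : PermeableHypersurface.IsUnitNormal g ι U N)
    (φ : OpenPartialHomeomorph M (EuclideanSpace ℝ (Fin m)))
    (hφ : φ ∈ IsManifold.maximalAtlas (𝓡 m) ∞ M)
    (ψ : OpenPartialHomeomorph M' (EuclideanSpace ℝ (Fin (m + 1))))
    (hψ : ψ ∈ IsManifold.maximalAtlas (𝓡 (m + 1)) ∞ M')
    (P : PermeableHypersurface.Patch m) (hP : P = PermeableHypersurface.patch g ι N φ ψ)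
    (x : EuclideanSpace ℝ (Fin m)) (hx : x ∈ PermeableHypersurface.patchDomain ι U φ ψ) :
    P.IsOuterConnectionMatrix (P.nablaT 1 x) x ∧
    (∀ t : ℝ, PermeableHypersurface.HasTimeDerivAt
      (fun τ : ℝ => (((τ : ℂ) ^ 2 / (4 * (Real.pi : ℂ) ^ 2)) • P.xi x) *
        PermeableHypersurface.evalSqrt (PermeableHypersurface.LF F)
          (((τ : ℂ) ^ 2 / (4 * (Real.pi : ℂ) ^ 2)) • PermeableHypersurface.extD P.xi x))
      (PermeableHypersurface.logTransgression F (P.nablaT t) P.wedgeN x) t) ∧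
    PermeableHypersurface.transgression F P.nablaT x =
      PermeableHypersurface.timeIntegral (fun t : ℝ =>
        PermeableHypersurface.evalSqrt F
          (((t : ℂ) ^ 2 / (4 * (Real.pi : ℂ) ^ 2)) • PermeableHypersurface.extD P.xi x) *
        PermeableHypersurface.timeDeriv
          (fun τ : ℝ => (((τ : ℂ) ^ 2 / (4 * (Real.pi : ℂ) ^ 2)) • P.xi x) *
            PermeableHypersurface.evalSqrt (PermeableHypersurface.LF F)
              (((τ : ℂ) ^ 2 / (4 * (Real.pi : ℂ) ^ 2)) • PermeableHypersurface.extD P.xi x)) t)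
        0 1 := by
  have hreg : P.IsRegularOn (PermeableHypersurface.patchDomain ι U φ ψ) :=
    hP ▸ PermeableHypersurface.patch_isRegularOn g hι hU hN hφ hψ
  have hp : P.IsPermeableOn (PermeableHypersurface.patchDomain ι U φ ψ) :=
    hP ▸ hperm U N hU hN φ hφ ψ hψ
  have hderiv := hreg.hasTimeDerivAt_xi_mul_evalSqrt_LF hp F hx
  refine ⟨hreg.isOuterConnectionMatrix hx, hderiv, ?_⟩
  rw [hreg.transgression_nablaT hp hF hx]
  congr 1
  ext t
  rw [(hderiv t).timeDeriv_eq]
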